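/- Conventions. A valuation of a field $K$ is a map $v\colon K\smallsetminus\{0\}\to\mathbb R$ which is either a homomorphism with $v(a+b)\ge\min(v(a),v(b))$, or of the form $v(a)=-c\log|\sigma(a)|$ for a ring homomorphism $\sigma\colon K\to\mathbb C$ and some $c>0$; the set of valuations carries the topology of pointwise convergence. A globally valued field (GVF) structure on $K$ is a Borel measure $\mu_K$ on the space of valuations of $K$, concentrated on a Borel set $\Pi$ of nontrivial, pairwise inequivalent valuations (equivalent means differing by a positive factor), such that for every $a\in K\smallsetminus\{0\}$ the function $v\mapsto v(a)$ is integrable and $\int v(a)\,d\mu_K(v)=0$. A GVF structure $\nu$ on an extension field $F$ extends $\mu_K$ if restriction to $K$ pushes the restriction of $\nu$ to the valuations nontrivial on $K$ forward to $\mu_K$. Let $K$ be a countable field with a GVF structure $(\Pi,\mu_K)$. Let $X\subset\mathbb P^n_K$ be an irreducible closed subvariety not contained in the hyperplane $T_0=0$, let $D$ be the (very ample) divisor cut out on $X$ by $T_0=0$, let $x_i=T_i/T_0\in K(X)$, and let $X_{\mathrm{aff}}=X\smallsetminus D$, with coordinate ring $K[x]=K[x_1,\dots,x_n]$. Let $L(mD)$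 be the space of $f\in K(X)$ with poles at most $mD$; it is contained in $K[x]$. The Berkovich space $X_{\mathrm{aff}}^{\mathrm{an}}$ is the set of all semivaluations $v\colon K[x]\to\mathbb R\cup\{+\infty\}$, defined in the same two ways (with a ring homomorphism $\sigma\colon K[x]\to\mathbb C$ in the second), again with the topology of pointwise convergence; such a $v$ lies above $p$ if $v|_K=p$. Let $S\subset\Pi$ be compact, and let $A$ be a $D$-adelic set above $S$, i.e. a compact subset of $X_{\mathrm{aff}}^{\mathrm{an}}$ all of whose points lie above points of $S$. For $p\in S$ let $A_p$ be the set of points of $A$ above $p$; for $p\notin S$ let $A_p$ be the set of all points $v$ of $X_{\mathrm{aff}}^{\mathrm{an}}$ above $p$ with $v(x_i)\ge 0$ for all $i$. The Chebyshev constant $\mathrm{Ch}(A)\in[0,\infty]$ is defined by \[ -\log \mathrm{Ch}(A)=\lim_{m\to\infty}\frac1m\ \sup_{0\ne f\in L(mD)}\ \int_{p\in\Pi}\ \inf_{v\in A_p}v(f)\ d\mu_K(p), \] where $\inf\emptyset=+\infty$ (the negative part of the integrand is integrable, and the limit exists in $[0,\infty]$ by superadditivity). The adelic partial type $P_A$ is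 the set of (generic quantifier-free) types given by the GVF structures $\nu$ on $K(X)$ that extend $\mu_K$, such that $\nu$-almost every $v$ with $v|_K\in S$ satisfies $v|_{K[x]}\in A$, and such that, with $v^-=\max(0,-v)$ (and $v^-(0)=0$), \[ \int \max_i v^-(x_i)\,d\nu(v)=\int_{\{v\,:\,v|_K\in S\}}\max_i v^-(x_i)\,d\nu(v). \] Then $P_A$ is consistent, i.e. there is such a $\nu$, if and only if $\mathrm{Ch}(A)\ge 1$. -/

import Mathlib

open MeasureTheory Filter

noncomputable section

/-! ### Valuations and absolute values -/

/-- A real-valued (semi)valuation `v` of a commutative ring `R`, written multiplicatively as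
`|f| = exp (-v f)`: either a non-archimedean multiplicative seminorm, or a positive power of the
modulus of a ring homomorphism to `ℂ`. The elements `f` with `|f| = 0` are those with
`v f = +∞`. If `R` is a field there is no such `f` except `0`. -/
structure Place (R : Type*) [CommRing R] where
  toFun : R → ℝ
  nonneg : ∀ a, 0 ≤ toFun a
  zero : toFun 0 = 0
  one : toFun 1 = 1
  mul : ∀ a b, toFun (a * b) = toFun a * toFun b
  nonarch_or_arch : (∀ a b, toFun (a + b) ≤ max (toFun a) (toFun b)) ∨
    ∃ (σ : R →+* ℂ) (c : ℝ), 0 < c ∧ ∀ a, toFun a = ‖σ a‖ ^ c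

namespace Place

instance (R : Type*) [CommRing R] : CoeFun (Place R) (fun _ => R → ℝ) := ⟨Place.toFun⟩

/-- The topology of pointwise convergence. -/
instance (R : Type*) [CommRing R] : TopologicalSpace (Place R) :=
  TopologicalSpace.induced Place.toFun inferInstance

instance (R : Type*) [CommRing R] : MeasurableSpace (Place R) := borel _

instance (R : Type*) [CommRing R] : BorelSpace (Place R) := ⟨rfl⟩

/-- Pull-back of a valuation along a ring homomorphism. -/
def comap {R R' : Type*} [CommRing R] [CommRing R'] (φ : R →+* R') (v : Place R') : Place R where
  toFun a := v (φ a)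
  nonneg a := v.nonneg _
  zero := by rw [map_zero, v.zero]
  one := by rw [map_one, v.one]
  mul a b := by rw [map_mul, v.mul]
  nonarch_or_arch := by
    rcases v.nonarch_or_arch with h | ⟨σ, c, hc, h⟩
    · exact Or.inl fun a b => by rw [map_add]; exact h _ _
    · exact Or.inr ⟨σ.comp φ, c, hc, fun a => h _⟩

/-- Restriction of a valuation to the base field. -/
abbrev res (K : Type*) {R : Type*} [Field K] [CommRing R] [Algebra K R] (v : Place R) : Place K :=
  v.comap (algebraMap K R)

/-- The additive value `v f = -log |f|` in `(-∞, +∞]`. -/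
def ord {R : Type*} [CommRing R] (v : Place R) (f : R) : EReal :=
  -ENNReal.log (ENNReal.ofReal (v f))

/-- The additive value `v a = -log |a|` of a nonzero element of a field, as a real number. -/
def val {K : Type*} [Field K] (v : Place K) (a : K) : ℝ := -Real.log (v a)

def IsTrivial {K : Type*} [Field K] (v : Place K) : Prop := ∀ a : K, a ≠ 0 → v a = 1

/-- Equivalence: additively, one is a positive multiple of the other. -/
def Equivalent {K : Type*} [Field K] (v w : Place K) : Prop :=
  ∃ c : ℝ, 0 < c ∧ ∀ a : K, w a = v a ^ c

end Place

/-! ### Globally valued fields -/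

/-- A globally valued field structure: a measure, concentrated on a Borel set of representatives
of nontrivial valuations up to equivalence, satisfying the product formula. -/
structure GVF (K : Type*) [Field K] where
  reps : Set (Place K)
  measurableSet_reps : MeasurableSet reps
  nontrivial : ∀ v ∈ reps, ¬ v.IsTrivial
  inequivalent : ∀ v ∈ reps, ∀ w ∈ reps, v.Equivalent w → v = w
  measure : Measure (Place K)
  concentrated : measure repsᶜ = 0
  integrable : ∀ a : K, a ≠ 0 → Integrable (fun v => v.val a) measure
  product_formula : ∀ a : K, a ≠ 0 → ∫ v, v.val a ∂measure = 0

/-- `G'` on `F` induces `G` on `K`: restricting the valuations of `F` that are nontrivial on `K`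
to `K` pushes the measure of `G'` to that of `G`. -/
def GVF.Extends {K F : Type*} [Field K] [Field F] [Algebra K F] (G' : GVF F) (G : GVF K) : Prop :=
  (G'.measure.restrict {v | ¬ (v.res K).IsTrivial}).map (Place.res K) = G.measure

/-! ### Projective varieties with a hyperplane section -/

/-- An irreducible closed subvariety `X` of projective `n`-space over `K`, given by its
homogeneous prime ideal, not contained in the hyperplane `T₀ = 0`. It comes with the very ample
effective divisor `D` cut out on it by `T₀ = 0`. -/
structure ProjVariety (K : Type*) [Field K] (n : ℕ) where
  ideal : Ideal (MvPolynomial (Fin (n + 1)) K)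
  isPrime : ideal.IsPrime
  isHomogeneous : ∀ p ∈ ideal, ∀ d : ℕ, MvPolynomial.homogeneousComponent d p ∈ ideal
  X_zero_notMem : MvPolynomial.X 0 ∉ ideal

namespace ProjVariety

variable {K : Type*} [Field K] {n : ℕ}

/-- The homogeneous coordinate ring. -/
abbrev HomCoordRing (X : ProjVariety K n) : Type _ :=
  MvPolynomial (Fin (n + 1)) K ⧸ X.ideal

instance (X : ProjVariety K n) : IsDomain X.HomCoordRing :=
  (Ideal.Quotient.isDomain_iff_prime _).2 X.isPrime

/-- `Tᵢ / T₀` in the fraction field of the homogeneous coordinate ring. -/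
def ratio (X : ProjVariety K n) (i : Fin (n + 1)) : FractionRing X.HomCoordRing :=
  algebraMap X.HomCoordRing _ (Ideal.Quotient.mk X.ideal (MvPolynomial.X i)) /
    algebraMap X.HomCoordRing _ (Ideal.Quotient.mk X.ideal (MvPolynomial.X 0))

/-- The function field `K(X)`: the fractions of degree `0`, i.e. the subfield generated over `K`
by the `Tᵢ / T₀`. -/
def functionField (X : ProjVariety K n) : IntermediateField K (FractionRing X.HomCoordRing) :=
  IntermediateField.adjoin K (Set.range X.ratio)

/-- The coordinates `xᵢ = Tᵢ / T₀` as rational functions on `X`; in particular `x₀ = 1`. -/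
def coord (X : ProjVariety K n) (i : Fin (n + 1)) : X.functionField :=
  ⟨X.ratio i, IntermediateField.subset_adjoin K _ (Set.mem_range_self i)⟩

end ProjVariety

/-! ### Adelic sets, adelic types and the Chebyshev constant

In this section `F` is the function field of `X` and `x : Fin (n + 1) → F` the coordinates. -/

section Adelic

variable {K F : Type*} [Field K] [Field F] [Algebra K F] {n : ℕ}

/-- The coordinate ring `K[x]` of the affine variety `X ∖ D`. -/
abbrev affRing (K : Type*) {F : Type*} [Field K] [Field F] [Algebra K F] {n : ℕ}
    (x : Fin (n + 1) → F) : Subalgebra K F :=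
  Algebra.adjoin K (Set.range x)

/-- The generator `xᵢ` of `K[x]`. -/
def affCoord (K : Type*) {F : Type*} [Field K] [Field F] [Algebra K F] {n : ℕ}
    (x : Fin (n + 1) → F) (i : Fin (n + 1)) : affRing K x :=
  ⟨x i, Algebra.subset_adjoin (Set.mem_range_self i)⟩

/-- `L(mD)`: the rational functions `f` with `(f) + mD ≥ 0`. On the chart `Tᵢ ≠ 0` of `X` (which
is nonempty iff `xᵢ ≠ 0`) the ring of regular functions is `K[xⱼ / xᵢ]ⱼ` and `D` has the
equation `1 / xᵢ`. -/
def globalSections (K : Type*) {F : Type*} [Field K] [Field F] [Algebra K F] {n : ℕ}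
    (x : Fin (n + 1) → F) (m : ℕ) : Set F :=
  {f | ∀ i, x i ≠ 0 → f / x i ^ m ∈ Algebra.adjoin K (Set.range fun j => x j / x i)}

/-- `A` is a `D`-adelic set above `S`: `S` is a compact set of valuations of `K` contained in the
set of representatives, and `A` is a compact subset of the Berkovich space of `X ∖ D`, all
of whose points restrict to points of `S`. -/
structure IsAdelicSet (G : GVF K) (x : Fin (n + 1) → F) (S : Set (Place K))
    (A : Set (Place (affRing K x))) : Prop where
  isCompact_base : IsCompact S
  base_subset : S ⊆ G.reps
  isCompact : IsCompact A
  above : ∀ v ∈ A, v.res K ∈ S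

/-- The local height `maxᵢ v⁻(xᵢ) = maxᵢ log⁺ |xᵢ|`. -/
def localHeight (x : Fin (n + 1) → F) (v : Place F) : ℝ :=
  ⨆ i, Real.posLog (v (x i))

/-- The adelic type `P_A`: the types over `K` of generic points of `X`, that is, the globally
valued field structures on `F = K(X)` extending the one on `K`, such that the
measure above `S` concentrates on `A`, and the height of `x` is attained above `S`. -/
def adelicType (G : GVF K) (x : Fin (n + 1) → F) (S : Set (Place K))
    (A : Set (Place (affRing K x))) : Set (GVF F) :=
  {G' | G'.Extends G ∧
    (∀ᵐ v ∂G'.measure, v.res K ∈ S → v.comap (algebraMap (affRing K x) F) ∈ A) ∧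
    ∫ v, localHeight x v ∂G'.measure
      = ∫ v in {v | v.res K ∈ S}, localHeight x v ∂G'.measure}

open Classical in
/-- The set `A_p`: for `p ∈ S` the fibre of `A`, and for other `p` the set of points above `p`
of the Berkovich space of `X ∖ D` with integral coordinates. -/
def adelicFibre (x : Fin (n + 1) → F) (S : Set (Place K)) (A : Set (Place (affRing K x)))
    (p : Place K) : Set (Place (affRing K x)) :=
  if p ∈ S then {v | v ∈ A ∧ v.res K = p}
  else {v | v.res K = p ∧ ∀ i, v (affCoord K x i) ≤ 1}

/-- The integral of an extended-real function, as the integral of its positive part minus that of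
its negative part. -/
def eintegral {α : Type*} [MeasurableSpace α] (μ : Measure α) (g : α → EReal) : EReal :=
  ((∫⁻ a, (g a).toENNReal ∂μ : ENNReal) : EReal) - ((∫⁻ a, (-g a).toENNReal ∂μ : ENNReal) : EReal)

/-- `∫_p inf_{v ∈ A_p} v(f)`. The infimum over the empty set is `+∞`. -/
def infIntegral (G : GVF K) (x : Fin (n + 1) → F) (S : Set (Place K))
    (A : Set (Place (affRing K x))) (f : affRing K x) : EReal :=
  eintegral G.measure fun p => ⨅ v ∈ adelicFibre x S A p, v.ord f

/-- `a_m`, the supremum of `∫_p inf_{v ∈ A_p} v(f)` over the nonzero `f ∈ L(mD)`. As `x₀ = 1`, the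
chart `T₀ ≠ 0` in the definition of `L(mD)` shows that `L(mD)` is contained in `K[x]`. -/
def chebyshevTerm (G : GVF K) (x : Fin (n + 1) → F) (S : Set (Place K))
    (A : Set (Place (affRing K x))) (m : ℕ) : EReal :=
  ⨆ (f : affRing K x) (_ : (f : F) ∈ globalSections K x m) (_ : f ≠ 0), infIntegral G x S A f

/-- The Chebyshev constant `exp (-lim a_m / m)` in `[0, ∞]`. The sequence `a_m` is superadditive,
so the limit exists and is the upper limit. -/
def chebyshev (G : GVF K) (x : Fin (n + 1) → F) (S : Set (Place K))
    (A : Set (Place (affRing K x))) : ENNReal :=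
  EReal.exp (-(limsup (fun m : ℕ => chebyshevTerm G x S A m / (m : EReal)) atTop))

end Adelic

end

/-! ### The topology of the space of places -/

namespace Place

open Topology

variable {R : Type*} [CommRing R]

/-! Write `v(f) = -log |f|_v`, and let `Z` be the union of the fibres `A_p`. If `ν` realizes the
type, then `inf_{A_p} v(f)` is at most `v(f)` at almost every place nontrivial on `K`. By the
product formula on `K(X)`, the integral of `v(f)` over those places is minus the integral over the
places trivial on `K`. The latter have integral coordinates, because the height is carried by `S`,
so they contribute nonnegatively for `f` in `K[x]`. Hence every Chebyshev term is at most `0`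
(`infIntegral_nonpos_of_mem_adelicType`). Conversely, let `Ch(A) ≥ 1`. Taking powers of `f` shows
that `∫ h ≤ 0` for every integrable `h` on the base with `h ≤ v(f)` on `Z`
(`integral_nonpos_of_one_le_chebyshev`). A Hahn-Banach argument (`exists_linearMap_of_constraints`,
`exists_isCompatible`) turns this into a positive functional on functions on `Z` which restricts to
integration over the base and is nonpositive on every dominated `e ≤ v(f)`. The Riesz representation
theorem over compact pieces of the base makes it a measure `ν` on `Z` above `μ_K` with `∫ v(f) dν ≤
0` for all nonzero `f` in `K[x]` (`exists_measure_of_product_inequality`). The defect `φ(f) = -∫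
v(f) dν` is a homomorphism on the multiplicative group of `K(X)`, nonnegative on `K[x]`. Such a
homomorphism is a nonnegative combination of discrete valuations nonnegative on `K[x]`, hence
trivial on `K` (`exists_divisorial_representation`). Adding the corresponding point masses to `ν`
restores the product formula, and changes neither the measure above `K` nor the height. -/

theorem toFun_injective : Function.Injective (Place.toFun : Place R → R → ℝ) := by
  rintro ⟨⟩ ⟨⟩ h
  cases h
  rfl

theorem isEmbedding_toFun : IsEmbedding (Place.toFun : Place R → R → ℝ) :=
  ⟨⟨rfl⟩, toFun_injective⟩

theorem continuous_apply (f : R) : Continuous fun v : Place R => v f :=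
  (_root_.continuous_apply f).comp isEmbedding_toFun.continuous

theorem measurable_apply (f : R) : Measurable fun v : Place R => v f :=
  (continuous_apply f).measurable

instance : T2Space (Place R) := isEmbedding_toFun.t2Space

theorem continuous_comap {R' : Type*} [CommRing R'] (φ : R →+* R') :
    Continuous (Place.comap φ) :=
  isEmbedding_toFun.continuous_iff.2 <| continuous_pi fun a => continuous_apply (φ a)

theorem map_pow (v : Place R) (f : R) (k : ℕ) : v (f ^ k) = v f ^ k := by
  induction k with
  | zero => simp [v.one]
  | succ k ih => rw [pow_succ, v.mul, ih, pow_succ]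

/-- The weak triangle inequality, valid for both kinds of places. -/
theorem add_le (v : Place R) (a b : R) : v (a + b) ≤ max 1 (v 2) * max (v a) (v b) := by
  have hm : 0 ≤ max (v a) (v b) := le_max_of_le_left (v.nonneg a)
  rcases v.nonarch_or_arch with h | ⟨σ, c, hc, h⟩
  · exact (h a b).trans (le_mul_of_one_le_left hm (le_max_left _ _))
  · refine le_trans ?_ (mul_le_mul_of_nonneg_right (le_max_right _ _) hm)
    have h2 : v 2 = 2 ^ c := by rw [h, map_ofNat, RCLike.norm_ofNat]
    have hmx : max (v a) (v b) = (max ‖σ a‖ ‖σ b‖) ^ c := by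
      rw [h, h]
      exact ((Real.monotoneOn_rpow_Ici_of_exponent_nonneg hc.le).map_max
        (norm_nonneg _) (norm_nonneg _)).symm
    rw [h2, hmx, h, map_add, ← Real.mul_rpow (by norm_num) (le_max_of_le_left (norm_nonneg _))]
    refine Real.rpow_le_rpow (norm_nonneg _) ((norm_add_le _ _).trans ?_) hc.le
    linarith [le_max_left ‖σ a‖ ‖σ b‖, le_max_right ‖σ a‖ ‖σ b‖]

/-- In the archimedean case the exponent equals `log₂ |2|`, so it converges. If its limit is `0`,
the constant in `add_le` tends to `1` and the limit is ultrametric. Otherwise the homomorphisms to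
`ℂ` are pointwise bounded and converge along the ultrafilter. -/
theorem exists_of_tendsto {α : Type*} (u : Ultrafilter α) (p : α → Place R) (x : R → ℝ)
    (hp : ∀ a, Tendsto (fun y => p y a) u (𝓝 (x a))) : ∃ v : Place R, v.toFun = x := by
  have hnn : ∀ a, 0 ≤ x a := fun a => ge_of_tendsto' (hp a) fun y => (p y).nonneg a
  have hzero : x 0 = 0 := tendsto_nhds_unique (hp 0) (by simp [Place.zero])
  have hone : x 1 = 1 := tendsto_nhds_unique (hp 1) (by simp [Place.one])
  have hmul : ∀ a b, x (a * b) = x a * x b := fun a b =>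
    tendsto_nhds_unique (hp (a * b)) (by simpa [Place.mul] using (hp a).mul (hp b))
  suffices h : (∀ a b, x (a + b) ≤ max (x a) (x b)) ∨
      ∃ (σ : R →+* ℂ) (c : ℝ), 0 < c ∧ ∀ a, x a = ‖σ a‖ ^ c from
    ⟨⟨x, hnn, hzero, hone, hmul, h⟩, rfl⟩
  have hor : ∀ᶠ y in (u : Filter α), (∀ a b, p y (a + b) ≤ max (p y a) (p y b)) ∨
      ∃ (σ : R →+* ℂ) (c : ℝ), 0 < c ∧ ∀ a, p y a = ‖σ a‖ ^ c :=
    Eventually.of_forall fun y => (p y).nonarch_or_arch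
  rcases Ultrafilter.eventually_or.1 hor with h | h
  · exact Or.inl fun a b => le_of_tendsto_of_tendsto (hp _) ((hp a).max (hp b))
      (h.mono fun y hy => hy a b)
  obtain ⟨y₀, σ₀, -⟩ := h.exists
  -- `σ₀` and `0` are default choices at the indices that are not archimedean; these do not matter
  -- along the ultrafilter.
  have : ∀ y, ∃ (σ : R →+* ℂ) (c : ℝ),
      (∃ (σ : R →+* ℂ) (c : ℝ), 0 < c ∧ ∀ a, p y a = ‖σ a‖ ^ c) →
        0 < c ∧ ∀ a, p y a = ‖σ a‖ ^ c := fun y => by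
    by_cases hy : ∃ (σ : R →+* ℂ) (c : ℝ), 0 < c ∧ ∀ a, p y a = ‖σ a‖ ^ c
    · obtain ⟨σ, c, H⟩ := hy
      exact ⟨σ, c, fun _ => H⟩
    · exact ⟨σ₀, 0, fun H => (hy H).elim⟩
  choose σ c hσ using this
  replace h : ∀ᶠ y in (u : Filter α), 0 < c y ∧ ∀ a, p y a = ‖σ y a‖ ^ c y :=
    h.mono fun y hy => hσ y hy
  have h2 : ∀ᶠ y in (u : Filter α), p y 2 = 2 ^ c y := h.mono fun y hy => by
    rw [hy.2, map_ofNat, RCLike.norm_ofNat]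
  have hx2 : 1 ≤ x 2 := ge_of_tendsto (hp 2) <| (h.and h2).mono fun y hy => by
    rw [hy.2]; exact Real.one_le_rpow (by norm_num) hy.1.1.le
  have hc : Tendsto c u (𝓝 (Real.logb 2 (x 2))) := by
    have := (Real.continuousAt_logb (b := 2) (by linarith : x 2 ≠ 0)).tendsto.comp (hp 2)
    refine this.congr' (h2.mono fun y hy => ?_)
    simp only [Function.comp_apply]
    rw [hy, Real.logb_rpow (by norm_num) (by norm_num)]
  rcases hx2.eq_or_lt with hx | hx
  · refine Or.inl fun a b => ?_
    have := le_of_tendsto_of_tendsto' (hp (a + b))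
      ((tendsto_const_nhds.max (hp 2)).mul ((hp a).max (hp b))) fun y => (p y).add_le a b
    simpa [← hx] using this
  set c₀ := Real.logb 2 (x 2) with hc₀
  have hc₀pos : 0 < c₀ := Real.logb_pos (by norm_num) hx
  have hnorm : ∀ a, Tendsto (fun y => ‖σ y a‖) u (𝓝 (x a ^ c₀⁻¹)) := fun a => by
    refine ((hp a).rpow (hc.inv₀ hc₀pos.ne') (Or.inr (inv_pos.2 hc₀pos))).congr'
      (h.mono fun y hy => ?_)
    rw [hy.2, Real.rpow_rpow_inv (norm_nonneg _) hy.1.ne']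
  have hlim : ∀ a, ∃ z : ℂ, Tendsto (fun y => σ y a) u (𝓝 z) := fun a => by
    have hb : ∀ᶠ y in (u : Filter α), σ y a ∈ Metric.closedBall (0 : ℂ) (x a ^ c₀⁻¹ + 1) :=
      ((hnorm a).eventually (eventually_le_nhds (lt_add_one _))).mono fun y hy => by
        simpa using hy
    obtain ⟨z, -, hz⟩ := (isCompact_closedBall (0 : ℂ) (x a ^ c₀⁻¹ + 1)).ultrafilter_le_nhds
      (u.map fun y => σ y a) (le_principal_iff.2 hb)
    exact ⟨z, hz⟩
  choose z hz using hlim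
  let τ : R →+* ℂ :=
    { toFun := z
      map_one' := tendsto_nhds_unique (hz 1) (by simp)
      map_mul' := fun a b => tendsto_nhds_unique (hz _) (by simpa using (hz a).mul (hz b))
      map_zero' := tendsto_nhds_unique (hz 0) (by simp)
      map_add' := fun a b => tendsto_nhds_unique (hz _) (by simpa using (hz a).add (hz b)) }
  refine Or.inr ⟨τ, c₀, hc₀pos, fun a => ?_⟩
  rw [show ‖τ a‖ = x a ^ c₀⁻¹ from tendsto_nhds_unique (hz a).norm (hnorm a),
    Real.rpow_inv_rpow (hnn a) hc₀pos.ne']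

/-- Closedness in `R → ℝ` yields both the Polish topology for countable `R` and compactness from
pointwise bounds by Tychonoff's theorem. -/
theorem isClosed_range_toFun : IsClosed (Set.range (Place.toFun : Place R → R → ℝ)) := by
  rw [isClosed_iff_ultrafilter]
  intro x u hu hmem
  obtain ⟨_, v₀, -⟩ := u.nonempty_of_mem hmem
  have : ∀ y : R → ℝ, ∃ v : Place R, y ∈ Set.range (Place.toFun : Place R → R → ℝ) → v.toFun = y :=
    fun y => by
      by_cases hy : y ∈ Set.range (Place.toFun : Place R → R → ℝ)
      · exact ⟨hy.choose, fun _ => hy.choose_spec⟩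
      · exact ⟨v₀, fun h => (hy h).elim⟩
  choose p hp using this
  refine exists_of_tendsto u p x fun a => ?_
  have h : Tendsto (fun y : R → ℝ => y a) u (𝓝 (x a)) :=
    ((_root_.continuous_apply a).tendsto x).mono_left hu
  refine h.congr' ?_
  filter_upwards [hmem] with y hy
  rw [hp y hy]

theorem isClosedEmbedding_toFun : IsClosedEmbedding (Place.toFun : Place R → R → ℝ) :=
  ⟨isEmbedding_toFun, isClosed_range_toFun⟩

instance [Countable R] : PolishSpace (Place R) := isClosedEmbedding_toFun.polishSpace

/-- A closed set of places that is bounded at every element of the ring is compact. -/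
theorem isCompact_of_isClosed {s : Set (Place R)} (hs : IsClosed s)
    (hb : ∀ f, ∃ C : ℝ, ∀ v ∈ s, v f ≤ C) : IsCompact s := by
  choose C hC using hb
  have hK : IsCompact (Place.toFun ⁻¹' Set.pi Set.univ fun f : R => Set.Icc 0 (C f)) :=
    isClosedEmbedding_toFun.isCompact_preimage (isCompact_univ_pi fun _ => isCompact_Icc)
  exact hK.of_isClosed_subset hs fun v hv f _ => ⟨v.nonneg f, hC f v hv⟩

end Place

/-! ### A separation lemma -/

/-- Let `Γ` be an additive family of constraints `0 ≤ Λ e + t` on a linear functional `Λ`. If no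
constraint on the zero vector is violated, and the segment from `0` to every vector is bounded below,
then there is a functional subject to all constraints. -/
theorem exists_linearMap_of_constraints {E : Type*} [AddCommGroup E] [Module ℝ E]
    (Γ : AddSubmonoid (E × ℝ)) (hup : ∀ e t t', t ≤ t' → (e, t) ∈ Γ → (e, t') ∈ Γ)
    (hzero : ∀ t, ((0 : E), t) ∈ Γ → 0 ≤ t)
    (habs : ∀ e : E, ∃ u : ℝ, ∀ r : ℝ, 0 ≤ r → r ≤ 1 → (r • e, u) ∈ Γ) :
    ∃ Λ : E →ₗ[ℝ] ℝ, ∀ e t, (e, t) ∈ Γ → 0 ≤ Λ e + t := by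
  -- `Γ` is only stable under addition. Its asymptotic cone, where a bounded error `B` is allowed
  -- along all integer multiples, is stable under real scaling as well.
  let s : PointedCone ℝ (E × ℝ) :=
    { carrier := {x | ∃ B : ℝ, ∀ k : ℕ, ((k : ℝ) • x.1, k * x.2 + B) ∈ Γ}
      add_mem' := by
        rintro ⟨e, t⟩ ⟨e', t'⟩ ⟨B, hB⟩ ⟨B', hB'⟩
        refine ⟨B + B', fun k => ?_⟩
        convert Γ.add_mem (hB k) (hB' k) using 1
        simp only [Prod.mk_add_mk, smul_add, Prod.mk.injEq, true_and]
        ring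
      zero_mem' := ⟨0, fun k => by simp [← Prod.zero_eq_mk, Γ.zero_mem]⟩
      smul_mem' := by
        rintro ⟨r, hr⟩ ⟨e, t⟩ ⟨B, hB⟩
        obtain ⟨u, hu⟩ := habs (-e)
        refine ⟨B + u + |t|, fun k => ?_⟩
        have hkr : 0 ≤ (k : ℝ) * r := mul_nonneg k.cast_nonneg hr
        have h1 : (k : ℝ) * r ≤ ⌈(k : ℝ) * r⌉₊ := Nat.le_ceil _
        have h2 : (⌈(k : ℝ) * r⌉₊ : ℝ) < k * r + 1 := Nat.ceil_lt_add_one hkr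
        -- The real multiple `k * r` is rounded up to an integer; the excess, which lies in `[0,
        -- 1]`, is removed by a constraint on the segment from `0` to `-e`.
        have := Γ.add_mem (hB ⌈(k : ℝ) * r⌉₊) (hu (⌈(k : ℝ) * r⌉₊ - k * r) (by linarith)
          (by linarith))
        rw [Prod.mk_add_mk, smul_neg, ← sub_eq_add_neg, ← sub_smul, sub_sub_cancel] at this
        change ((k : ℝ) • (r • e), (k : ℝ) * (r * t) + (B + u + |t|)) ∈ Γ
        rw [smul_smul]
        refine hup _ _ _ ?_ this
        nlinarith [le_abs_self t, neg_abs_le t, abs_nonneg t] }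
  -- The functional to be extended is `(0, t) ↦ t`; positivity of the extension on the cone is
  -- exactly the family of constraints.
  let f : E × ℝ →ₗ.[ℝ] ℝ :=
    { domain := LinearMap.ker (LinearMap.fst ℝ E ℝ)
      toFun := (LinearMap.snd ℝ E ℝ).comp (Submodule.subtype _) }
  obtain ⟨g, hg, hgs⟩ := riesz_extension s f
    (by
      rintro ⟨⟨e, t⟩, he⟩ ⟨B, hB⟩
      have he : e = 0 := he
      subst he
      change 0 ≤ t
      by_contra! ht
      obtain ⟨k, hk⟩ := exists_nat_gt (B / -t)
      rw [div_lt_iff₀ (by linarith)] at hk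
      have := hzero _ (by simpa using hB k)
      linarith)
    (by
      rintro ⟨e, t⟩
      obtain ⟨u, hu⟩ := habs e
      refine ⟨⟨(0, u - t), by simp [f]⟩, 0, fun k => ?_⟩
      have := Γ.nsmul_mem (hu 1 zero_le_one le_rfl) k
      simpa [← Nat.cast_smul_eq_nsmul ℝ] using this)
  refine ⟨g.comp (LinearMap.inl ℝ E ℝ), fun e t h => ?_⟩
  have h1 : 0 ≤ g (e, t) := hgs _ ⟨0, fun k => by
    simpa [← Nat.cast_smul_eq_nsmul ℝ] using Γ.nsmul_mem h k⟩
  have h2 : g (0, t) = t := hg ⟨(0, t), by simp [f]⟩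
  have h3 : g (e, t) = g (e, 0) + g (0, t) := by rw [← map_add]; simp
  rw [h3, h2] at h1
  simpa using h1

/-! ### Normalized discrete places of finite separable extensions -/

namespace Place

/-- A place with value group `exp ℤ`. -/
def IsNormalized {F : Type*} [Field F] (v : Place F) : Prop :=
  (∀ f : F, f ≠ 0 → ∃ k : ℤ, v f = Real.exp k) ∧ ∃ f : F, v f = Real.exp 1

/-- The exponent relating the two places is a positive integer whose inverse is also an integer. -/
theorem IsNormalized.eq_of_equivalent {F : Type*} [Field F] {v w : Place F} (hv : v.IsNormalized)
    (hw : w.IsNormalized) (h : v.Equivalent w) : v = w := by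
  obtain ⟨c, hc, h⟩ := h
  have ne : ∀ (u : Place F) (f : F), u f = Real.exp 1 → f ≠ 0 := fun u f hf h0 => by
    rw [h0, u.zero] at hf
    exact (Real.exp_pos 1).ne hf
  obtain ⟨f, hf⟩ := hv.2
  obtain ⟨g, hg⟩ := hw.2
  obtain ⟨k, hk⟩ := hw.1 f (ne v f hf)
  obtain ⟨m, hm⟩ := hv.1 g (ne w g hg)
  have h1 : c = k := by
    have := h f
    rw [hk, hf, ← Real.exp_mul, one_mul, Real.exp_eq_exp] at this
    exact this.symm
  have h2 : (1 : ℝ) = m * c := by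
    have := h g
    rw [hg, hm, ← Real.exp_mul, Real.exp_eq_exp] at this
    exact this
  have hc1 : c = 1 := by
    rw [h1] at h2 hc
    norm_cast at h2 hc
    have : k = 1 := by
      have := Int.eq_one_or_neg_one_of_mul_eq_one' h2.symm
      omega
    rw [h1, this, Int.cast_one]
  refine toFun_injective (funext fun a => ?_)
  rw [h a, hc1, Real.rpow_one]

theorem one_lt_toNNReal_exp_one : 1 < Real.toNNReal (Real.exp 1) :=
  Real.one_lt_toNNReal.2 (Real.one_lt_exp_iff.2 one_pos)

open WithZero in
/-- The place attached to a discrete valuation. -/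
noncomputable def ofValuation {F : Type*} [Field F] (v : Valuation F ℤᵐ⁰) : Place F where
  toFun f := WithZeroMulInt.toNNReal one_lt_toNNReal_exp_one.ne_zero (v f)
  nonneg _ := NNReal.coe_nonneg _
  zero := by simp
  one := by simp
  mul a b := by simp
  nonarch_or_arch := by
    refine Or.inl fun a b => ?_
    have hm := (WithZeroMulInt.toNNReal_strictMono one_lt_toNNReal_exp_one).monotone
    rw [← NNReal.coe_max, ← hm.map_max]
    exact_mod_cast hm (v.map_add a b)

open WithZero in
theorem ofValuation_le_one {F : Type*} [Field F] (v : Valuation F ℤᵐ⁰) (f : F) :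
    ofValuation v f ≤ 1 ↔ v f ≤ 1 := by
  rw [← (WithZeroMulInt.toNNReal_strictMono one_lt_toNNReal_exp_one).le_iff_le, map_one,
    ← NNReal.coe_le_coe]
  rfl

open WithZero in
theorem ofValuation_isNormalized {F : Type*} [Field F] (v : Valuation F ℤᵐ⁰)
    (hv : Function.Surjective v) : (ofValuation v).IsNormalized := by
  have key : ∀ (f : F) (k : ℤ), v f = exp k → ofValuation v f = Real.exp k := fun f k hk => by
    have h0 : v f ≠ 0 := by rw [hk]; exact exp_ne_zero
    change ((WithZeroMulInt.toNNReal _ (v f) : NNReal) : ℝ) = _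
    rw [WithZeroMulInt.toNNReal_neg_apply _ h0]
    have : WithZero.unzero h0 = Multiplicative.ofAdd k := by
      apply WithZero.coe_injective
      rw [WithZero.coe_unzero, hk]
      rfl
    rw [this, NNReal.coe_zpow, toAdd_ofAdd, ← Real.rpow_intCast,
      Real.coe_toNNReal _ (Real.exp_pos 1).le]
    exact (Real.exp_one_rpow _)
  refine ⟨fun f hf => ⟨log (v f), key f _ (exp_log ((Valuation.ne_zero_iff v).2 hf)).symm⟩, ?_⟩
  obtain ⟨f, hf⟩ := hv (exp 1)
  exact ⟨f, by simpa using key f 1 hf⟩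

theorem apply_inv {F : Type*} [Field F] (v : Place F) (f : F) : v f⁻¹ = (v f)⁻¹ := by
  rcases eq_or_ne f 0 with rfl | h
  · simp [v.zero]
  · refine eq_inv_of_mul_eq_one_left ?_
    rw [← v.mul, inv_mul_cancel₀ h, v.one]

theorem pos_of_ne_zero {F : Type*} [Field F] (v : Place F) {f : F} (h : f ≠ 0) : 0 < v f := by
  refine (v.nonneg f).lt_of_ne fun h0 => ?_
  have := v.mul f f⁻¹
  rw [← h0, zero_mul, mul_inv_cancel₀ h, v.one] at this
  exact one_ne_zero this

theorem eq_one_of_le_one {F : Type*} [Field F] (v : Place F) {f : F} (h0 : f ≠ 0) (h : v f ≤ 1)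
    (h' : v f⁻¹ ≤ 1) : v f = 1 := by
  rw [apply_inv, inv_le_one₀ (v.pos_of_ne_zero h0)] at h'
  exact h.antisymm h'

end Place

-- Separability gives a Dedekind integral closure, whose height-one primes supply the places. An
-- element integral at all of these lies in the closure.
open IsDedekindDomain in
theorem exists_places_of_isDedekindDomain {D E L : Type*} [CommRing D] [Field E] [Field L]
    [Algebra D E] [IsFractionRing D E] [Algebra E L] [Algebra D L] [IsScalarTower D E L]
    [FiniteDimensional E L] [Algebra.IsSeparable E L] [IsDedekindDomain D] :
    ∃ w : HeightOneSpectrum (integralClosure D L) → Place L,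
      (∀ i f, IsIntegral D f → w i f ≤ 1) ∧ (∀ i, (w i).IsNormalized) ∧
      (∀ f ≠ 0, {i | w i f ≠ 1}.Finite) ∧ ∀ f, (∀ i, w i f ≤ 1) → IsIntegral D f := by
  have := integralClosure.isDedekindDomain D E L
  have : IsFractionRing (integralClosure D L) L :=
    integralClosure.isFractionRing_of_finite_extension E L
  refine ⟨fun i => Place.ofValuation (i.valuation L), fun i f hf => ?_,
    fun i => Place.ofValuation_isNormalized _ (i.valuation_surjective L), fun f hf => ?_,
    fun f hf => ?_⟩
  · rw [Place.ofValuation_le_one]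
    exact i.valuation_le_one (⟨f, hf⟩ : integralClosure D L)
  · refine ((HeightOneSpectrum.Support.finite (integralClosure D L) f).union
      (HeightOneSpectrum.Support.finite (integralClosure D L) f⁻¹)).subset fun i hi => ?_
    by_contra h
    simp only [HeightOneSpectrum.Support, Set.mem_union, Set.mem_ofPred_eq, not_or, not_lt,
      ← Place.ofValuation_le_one] at h
    exact hi (Place.eq_one_of_le_one _ hf h.1 h.2)
  · obtain ⟨g, rfl⟩ := HeightOneSpectrum.mem_integers_of_valuation_le_one
      (R := integralClosure D L) L f fun i => (Place.ofValuation_le_one _ _).1 (hf i)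
    exact g.2

/-! ### Local rings of a factorial domain at its prime elements. -/

section Localization

variable {B E : Type*} [CommRing B] [IsDomain B] [Field E] [Algebra B E] [IsFractionRing B E]

/-- The local ring of `B` at a prime element, inside the fraction field. -/
noncomputable abbrev primeLocalization (E : Type*) [Field E] [Algebra B E] [IsFractionRing B E] (𝔭 : Ideal B)
    [𝔭.IsPrime] : Subalgebra B E :=
  Localization.subalgebra.ofField E 𝔭.primeCompl 𝔭.primeCompl_le_nonZeroDivisors

theorem mem_primeLocalization {𝔭 : Ideal B} [𝔭.IsPrime] {e : E} :
    e ∈ primeLocalization E 𝔭 ↔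
      ∃ a s : B, s ∉ 𝔭 ∧ e = algebraMap B E a * (algebraMap B E s)⁻¹ := by
  change (∃ (a s : B) (_ : s ∈ 𝔭.primeCompl), _) ↔ _
  simp [Ideal.primeCompl]

/-- A Noetherian local domain with principal maximal ideal is Dedekind. -/
theorem isDedekindDomain_primeLocalization [IsNoetherianRing B] {π : B}
    [(Ideal.span {π}).IsPrime] : IsDedekindDomain (primeLocalization E (Ideal.span {π})) := by
  have hloc : IsLocalization.AtPrime (primeLocalization E (Ideal.span {π})) (Ideal.span {π}) :=
    Localization.subalgebra.isLocalization_ofField E _ _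
  have := IsLocalization.AtPrime.isLocalRing (primeLocalization E (Ideal.span {π}))
    (Ideal.span {π})
  have := IsLocalization.isNoetherianRing (Ideal.span {π}).primeCompl
    (primeLocalization E (Ideal.span {π})) inferInstance
  refine ((tfae_of_isNoetherianRing_of_isLocalRing_of_isDomain
    (primeLocalization E (Ideal.span {π}))).out 4 2).1 ?_
  rw [← IsLocalization.AtPrime.map_eq_maximalIdeal (Ideal.span {π}), Ideal.map_span,
    Set.image_singleton]
  exact ⟨_, rfl⟩

/-- A prime factor of the reduced denominator would also divide the numerator, since `e` is defined
at that prime. -/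
theorem mem_range_of_forall_mem_primeLocalization [UniqueFactorizationMonoid B] {e : E}
    (h : ∀ (π : B) (_ : Prime π) (_ : (Ideal.span {π}).IsPrime),
      e ∈ primeLocalization E (Ideal.span {π})) : e ∈ (algebraMap B E).range := by
  have hden : IsUnit (IsFractionRing.den B e : B) := by
    by_contra hu
    obtain ⟨π, hπ, hdvd⟩ := WfDvdMonoid.exists_irreducible_factor hu
      (nonZeroDivisors.ne_zero (IsFractionRing.den B e).2)
    have hπ := hπ.prime
    have hp : (Ideal.span {π}).IsPrime := (Ideal.span_singleton_prime hπ.ne_zero).2 hπ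
    obtain ⟨a, s, hs, he⟩ := mem_primeLocalization.1 (h π hπ hp)
    rw [Ideal.mem_span_singleton] at hs
    have hs0 : algebraMap B E s ≠ 0 := fun h0 => hs (by
      rw [(IsFractionRing.injective B E) (h0.trans (map_zero _).symm)]; exact dvd_zero π)
    have hd0 : algebraMap B E (IsFractionRing.den B e) ≠ 0 := fun h0 =>
      nonZeroDivisors.ne_zero (IsFractionRing.den B e).2
        ((IsFractionRing.injective B E) (h0.trans (map_zero _).symm))
    have hnd : e = algebraMap B E (IsFractionRing.num B e) *
        (algebraMap B E (IsFractionRing.den B e))⁻¹ := by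
      conv_lhs => rw [← IsFractionRing.mk'_num_den' B e]
      exact div_eq_mul_inv _ _
    have : IsFractionRing.num B e * s = a * IsFractionRing.den B e := by
      apply IsFractionRing.injective B E
      rw [map_mul, map_mul]
      have h2 := hnd.symm.trans he
      field_simp at h2
      linear_combination h2
    have hn : π ∣ IsFractionRing.num B e :=
      (hπ.dvd_or_dvd (this ▸ hdvd.mul_left a)).resolve_right hs
    exact hπ.not_isUnit (IsFractionRing.num_den_reduced B e hn hdvd)
  obtain ⟨b, hb⟩ := hden
  refine ⟨IsFractionRing.num B e * ↑b⁻¹, ?_⟩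
  conv_rhs => rw [← IsFractionRing.mk'_num_den' B e]
  rw [map_mul, div_eq_mul_inv, ← hb]
  congr 1
  refine eq_inv_of_mul_eq_one_left ?_
  rw [← map_mul, Units.inv_mul, map_one]

/-- Each local ring is integrally closed, so it contains the coefficients of the minimal polynomial
of `f` over `E`. The intersection of these local rings is `B`. -/
theorem IsIntegral.of_forall_primeLocalization [UniqueFactorizationMonoid B] [IsNoetherianRing B]
    {L : Type*} [Field L] [Algebra E L] [Algebra B L] [IsScalarTower B E L] {f : L}
    (h : ∀ (π : B) (_ : Prime π) (_ : (Ideal.span {π}).IsPrime),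
      IsIntegral (primeLocalization E (Ideal.span {π})) f)
    (hE : IsIntegral E f) : IsIntegral B f := by
  have hc : ∀ i, (minpoly E f).coeff i ∈ (algebraMap B E).range := fun i => by
    refine mem_range_of_forall_mem_primeLocalization fun π hπ hp => ?_
    have := isDedekindDomain_primeLocalization (E := E) (π := π)
    have := minpoly.isIntegrallyClosed_eq_field_fractions E L (h π hπ hp)
    rw [Algebra.algebraMap_self, RingHom.id_apply] at this
    rw [this, Polynomial.coeff_map]
    exact Subtype.property _
  have hq' : (minpoly E f) ∈ Polynomial.lifts (algebraMap B E) :=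
    (Polynomial.lifts_iff_coeff_lifts (minpoly E f)).2 hc
  obtain ⟨r, hr, -, hmon⟩ := Polynomial.lifts_and_natDegree_eq_and_monic hq' (minpoly.monic hE)
  refine ⟨r, hmon, ?_⟩
  rw [IsScalarTower.algebraMap_eq B E L, ← Polynomial.eval₂_map, hr]
  exact minpoly.aeval E f

end Localization

universe uB uE uL

theorem exists_places_of_uniqueFactorizationMonoid {B : Type uB} {E : Type uE} {L : Type uL}
    [CommRing B] [IsDomain B] [UniqueFactorizationMonoid B] [IsNoetherianRing B] [Field E]
    [Algebra B E] [IsFractionRing B E] [Field L] [Algebra E L] [Algebra B L] [IsScalarTower B E L]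
    [FiniteDimensional E L] [Algebra.IsSeparable E L] :
    ∃ (ι : Type max uB uL) (w : ι → Place L),
      (∀ i f, IsIntegral B f → w i f ≤ 1) ∧ (∀ i, (w i).IsNormalized) ∧
      (∀ f ≠ 0, {i | w i f ≠ 1}.Finite) ∧ ∀ f, (∀ i, w i f ≤ 1) → IsIntegral B f := by
  let T := {𝔭 : Ideal B // ∃ π, Prime π ∧ 𝔭 = Ideal.span {π}}
  have hT : ∀ 𝔭 : T, 𝔭.1.IsPrime := by
    rintro ⟨_, π, hπ, rfl⟩
    exact (Ideal.span_singleton_prime hπ.ne_zero).2 hπ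
  have key : ∀ 𝔭 : T, ∃ (ι : Type uL) (w : ι → Place L),
      (∀ i f, IsIntegral (primeLocalization E 𝔭.1) f → w i f ≤ 1) ∧ (∀ i, (w i).IsNormalized) ∧
      (∀ f ≠ 0, {i | w i f ≠ 1}.Finite) ∧
      ∀ f, (∀ i, w i f ≤ 1) → IsIntegral (primeLocalization E 𝔭.1) f := by
    rintro ⟨_, π, hπ, rfl⟩
    have : (Ideal.span {π}).IsPrime := (Ideal.span_singleton_prime hπ.ne_zero).2 hπ
    have := isDedekindDomain_primeLocalization (E := E) (π := π)
    exact ⟨_, exists_places_of_isDedekindDomain (E := E)⟩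
  choose ι w h1 h2 h3 h4 using key
  have hint : ∀ (𝔭 : T) {f : L}, IsIntegral B f → IsIntegral (primeLocalization E 𝔭.1) f :=
    fun 𝔭 f hf => hf.tower_top
  refine ⟨Σ 𝔭, ι 𝔭, fun i => w i.1 i.2, fun i f hf => h1 _ _ _ (hint _ hf), fun i => h2 _ _,
    fun f hf => ?_, fun f hf => ?_⟩
  · have : Algebra.IsAlgebraic B L := by
      have := IsLocalization.isAlgebraic E (nonZeroDivisors B)
      exact Algebra.IsAlgebraic.trans B E L
    classical
    -- Away from the finitely many primes dividing this common denominator `b`, both `f` and `f⁻¹`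
    -- are integral, so only the places above those primes matter.
    obtain ⟨b, hb, hbf⟩ := Algebra.IsAlgebraic.exists_integral_multiples B {f, f⁻¹}
    have hfin : {𝔭 : T | b ∈ 𝔭.1}.Finite := by
      obtain ⟨s, hs, hsb⟩ := UniqueFactorizationMonoid.exists_prime_factors b hb
      refine Set.Finite.of_finite_image (f := Subtype.val) ?_ Subtype.val_injective.injOn
      refine ((s.toFinset.finite_toSet).image fun q => Ideal.span {q}).subset ?_
      rintro _ ⟨⟨_, π, hπ, rfl⟩, hmem, rfl⟩
      have hmem : π ∣ b := Ideal.mem_span_singleton.1 hmem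
      obtain ⟨q, hq, hdvd⟩ := hπ.exists_mem_multiset_dvd (hsb.dvd_iff_dvd_right.2 hmem)
      exact ⟨q, by simpa using hq, (Ideal.span_singleton_eq_span_singleton.2
        (hπ.associated_of_dvd (hs q hq) hdvd).symm)⟩
    have hone : ∀ 𝔭 : T, b ∉ 𝔭.1 → ∀ i : ι 𝔭, w 𝔭 i f = 1 := by
      intro 𝔭 hmem i
      have hbE : algebraMap B E b ≠ 0 := fun h0 =>
        hb ((IsFractionRing.injective B E) (h0.trans (map_zero _).symm))
      have hz : ∀ z : L, IsIntegral B (b • z) → IsIntegral (primeLocalization E 𝔭.1) z := by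
        intro z hz
        let β : primeLocalization E 𝔭.1 := ⟨(algebraMap B E b)⁻¹,
          mem_primeLocalization.2 ⟨1, b, hmem, by simp⟩⟩
        have : z = algebraMap (primeLocalization E 𝔭.1) L β * (b • z) := by
          rw [Algebra.smul_def, ← mul_assoc, IsScalarTower.algebraMap_apply B E L]
          change z = algebraMap E L (algebraMap B E b)⁻¹ * _ * z
          rw [← map_mul, inv_mul_cancel₀ hbE, map_one, one_mul]
        rw [this]
        exact isIntegral_algebraMap.mul (hint 𝔭 hz)
      exact Place.eq_one_of_le_one _ hf (h1 _ _ _ (hz _ (hbf _ (by simp))))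
        (h1 _ _ _ (hz _ (hbf _ (by simp))))
    have : {i : Σ 𝔭, ι 𝔭 | w i.1 i.2 f ≠ 1} ⊆
        ⋃ 𝔭 ∈ {𝔭 : T | b ∈ 𝔭.1}, Sigma.mk 𝔭 '' {i | w 𝔭 i f ≠ 1} := by
      rintro ⟨𝔭, i⟩ hi
      simp only [Set.mem_iUnion]
      exact ⟨𝔭, by_contra fun h => hi (hone 𝔭 h i), i, hi, rfl⟩
    exact (hfin.biUnion fun 𝔭 _ => (h3 𝔭 f hf).image _).subset this
  · refine IsIntegral.of_forall_primeLocalization (E := E) (fun π hπ hp => ?_)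
      (Algebra.IsIntegral.isIntegral f)
    exact h4 ⟨Ideal.span {π}, π, hπ, rfl⟩ f fun i => hf ⟨_, i⟩

/-! ### Positive functionals on divisors -/

namespace Place

theorem val_mul {F : Type*} [Field F] (v : Place F) {f g : F} (hf : f ≠ 0) (hg : g ≠ 0) :
    v.val (f * g) = v.val f + v.val g := by
  rw [val, v.mul, Real.log_mul (v.pos_of_ne_zero hf).ne' (v.pos_of_ne_zero hg).ne', val, val]
  ring

theorem val_one {F : Type*} [Field F] (v : Place F) : v.val 1 = 0 := by
  simp [val, v.one]

theorem val_inv {F : Type*} [Field F] (v : Place F) (f : F) : v.val f⁻¹ = -v.val f := by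
  simp [val, v.apply_inv]

theorem val_pow {F : Type*} [Field F] (v : Place F) (f : F) (k : ℕ) :
    v.val (f ^ k) = k * v.val f := by
  simp [val, v.map_pow]

theorem val_nonneg_iff {F : Type*} [Field F] (v : Place F) {f : F} :
    0 ≤ v.val f ↔ v f ≤ 1 := by
  rw [val, neg_nonneg, Real.log_nonpos_iff (v.nonneg f)]

theorem val_ne_zero_iff {F : Type*} [Field F] (v : Place F) {f : F} (hf : f ≠ 0) :
    v.val f ≠ 0 ↔ v f ≠ 1 := by
  have := v.pos_of_ne_zero hf
  rw [val, neg_ne_zero, Real.log_ne_zero]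
  constructor
  · exact fun h => h.2.1
  · exact fun h => ⟨this.ne', h, by linarith⟩

end Place

/-- A homomorphism `φ` on the multiplicative group of a field which is nonnegative on the elements with
effective divisor is a nonnegative combination of the valuations. -/
theorem exists_weights_of_nonneg {F : Type*} [Field F] {ι : Type*} (w : ι → Place F)
    (hfin : ∀ f ≠ 0, {i | w i f ≠ 1}.Finite)
    (heff : ∀ i, ∃ g ≠ 0, (∀ j, w j g ≤ 1) ∧ w i g < 1) (φ : F → ℝ)
    (hmul : ∀ f g, f ≠ 0 → g ≠ 0 → φ (f * g) = φ f + φ g)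
    (hnn : ∀ f ≠ 0, (∀ i, w i f ≤ 1) → 0 ≤ φ f) :
    ∃ c : ι → ℝ, (∀ i, 0 ≤ c i) ∧ ∀ f ≠ 0, φ f = ∑ᶠ i, c i * (w i).val f := by
  have h1 : φ 1 = 0 := by simpa using hmul 1 1 one_ne_zero one_ne_zero
  have hinv : ∀ f ≠ 0, φ f⁻¹ = -φ f := fun f hf => by
    have := hmul f f⁻¹ hf (inv_ne_zero hf)
    rw [mul_inv_cancel₀ hf, h1] at this
    linarith
  -- Every real divisor is dominated by an effective principal one, which supplies the segment
  -- bounds needed for the separation lemma.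
  have hdom : ∀ e : ι →₀ ℝ, ∃ g ≠ 0, ∀ i, |e i| ≤ (w i).val g := by
    intro e
    induction e using Finsupp.induction_linear with
    | zero => exact ⟨1, one_ne_zero, fun i => by simp [Place.val_one]⟩
    | add e e' h h' =>
      obtain ⟨g, hg, h⟩ := h
      obtain ⟨g', hg', h'⟩ := h'
      refine ⟨g * g', mul_ne_zero hg hg', fun i => ?_⟩
      rw [Place.val_mul _ hg hg']
      exact (abs_add_le _ _).trans (add_le_add (h i) (h' i))
    | single i a =>
      obtain ⟨g, hg, hj, hi⟩ := heff i
      have hpos : 0 < (w i).val g := (((w i).val_nonneg_iff).2 (hj i)).lt_of_ne'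
        (((w i).val_ne_zero_iff hg).2 hi.ne)
      obtain ⟨k, hk⟩ := exists_nat_gt (|a| / (w i).val g)
      rw [div_lt_iff₀ hpos] at hk
      classical
      refine ⟨g ^ k, pow_ne_zero k hg, fun j => ?_⟩
      rw [Place.val_pow, Finsupp.single_apply]
      split_ifs with h
      · exact h ▸ hk.le
      · rw [abs_zero]
        exact mul_nonneg k.cast_nonneg (((w j).val_nonneg_iff).2 (hj j))
  -- The constraints say `φ f ≤ Λ e` whenever `div f ≤ e`. Applied to `div f` and `div f⁻¹` they
  -- force `Λ (div f) = φ f`, and the weights are the values of `Λ` at the prime divisors.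
  let Γ : AddSubmonoid ((ι →₀ ℝ) × ℝ) :=
    { carrier := {x | ∃ f ≠ 0, (∀ i, (w i).val f ≤ x.1 i) ∧ -φ f ≤ x.2}
      add_mem' := by
        rintro x y ⟨f, hf, h, ht⟩ ⟨g, hg, h', ht'⟩
        refine ⟨f * g, mul_ne_zero hf hg, fun i => ?_, ?_⟩
        · rw [Place.val_mul _ hf hg]
          exact add_le_add (h i) (h' i)
        · rw [hmul f g hf hg, Prod.snd_add]
          linarith
      zero_mem' := ⟨1, one_ne_zero, fun i => by simp [Place.val_one], by simp [h1]⟩ }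
  obtain ⟨Λ, hΛ⟩ := exists_linearMap_of_constraints Γ
    (by
      rintro e t t' htt ⟨f, hf, h, ht⟩
      exact ⟨f, hf, h, ht.trans htt⟩)
    (by
      rintro t ⟨f, hf, h, ht⟩
      have := hnn f⁻¹ (inv_ne_zero hf) fun i => by
        rw [← Place.val_nonneg_iff, Place.val_inv]
        have := h i
        simp only [Finsupp.coe_zero, Pi.zero_apply] at this
        linarith
      rw [hinv f hf] at this
      exact this.trans ht)
    (by
      intro e
      obtain ⟨g, hg, h⟩ := hdom e
      refine ⟨φ g, fun r hr hr1 => ⟨g⁻¹, inv_ne_zero hg, fun i => ?_, ?_⟩⟩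
      · rw [Place.val_inv]
        have h2 := neg_abs_le (e i)
        have h3 := h i
        simp only [Finsupp.smul_apply, smul_eq_mul]
        nlinarith [abs_nonneg (e i)]
      · rw [hinv g hg, neg_neg])
  refine ⟨fun i => Λ (Finsupp.single i 1), fun i => ?_, fun f hf => ?_⟩
  · have := hΛ (Finsupp.single i 1) 0 ⟨1, one_ne_zero, fun j => ?_, by simp [h1]⟩
    · simpa using this
    · rw [Place.val_one]
      exact (Finsupp.single_nonneg.2 zero_le_one : (0 : ι →₀ ℝ) ≤ _) j
  · have hdiv : ∀ f ≠ 0, (Function.support fun i => (w i).val f).Finite := fun f hf =>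
      (hfin f hf).subset fun i hi => ((w i).val_ne_zero_iff hf).1 hi
    let d : ι →₀ ℝ := Finsupp.ofSupportFinite _ (hdiv f hf)
    have hd : Λ d = φ f := by
      have ha := hΛ d (-φ f) ⟨f, hf, fun i => le_rfl, le_rfl⟩
      have hb := hΛ (-d) (φ f) ⟨f⁻¹, inv_ne_zero hf, fun i => (Place.val_inv _ f).le,
        by rw [hinv f hf, neg_neg]⟩
      rw [map_neg] at hb
      linarith
    rw [← hd, finsum_eq_sum_of_support_subset (s := d.support)]
    · conv_lhs => rw [← Finsupp.sum_single d, Finsupp.sum, map_sum]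
      refine Finset.sum_congr rfl fun i _ => ?_
      rw [show Finsupp.single i (d i) = d i • Finsupp.single i (1 : ℝ) by simp, map_smul,
        smul_eq_mul, mul_comm]
      rfl
    · intro i hi
      rw [Finset.mem_coe, Finsupp.mem_support_iff]
      exact right_ne_zero_of_mul hi

/-- The representation is found on the separable closure `L` of `E` in `F` and transported through a
Frobenius power `ψ : F → L`: since `ψ f` is `f ^ q`, one has `φ f = φ (ψ f) / q`. -/
theorem exists_divisorial_representation_of_finite {B : Type uB} {R : Type uE} {F : Type uL}
    [CommRing B] [IsDomain B] [UniqueFactorizationMonoid B] [IsNoetherianRing B] [CommRing R]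
    [IsDomain R] [Field F] [Algebra B R] [Module.Finite B R] [FaithfulSMul B R] [Algebra R F]
    [IsFractionRing R F] (φ : F → ℝ) (hmul : ∀ f g, f ≠ 0 → g ≠ 0 → φ (f * g) = φ f + φ g)
    (hnn : ∀ f : R, f ≠ 0 → 0 ≤ φ (algebraMap R F f)) :
    ∃ (ι : Type max uB uL) (w : ι → Place F) (c : ι → ℝ), (∀ i, 0 ≤ c i) ∧
      (∀ i (f : R), w i (algebraMap R F f) ≤ 1) ∧ (∀ i, ¬ (w i).IsTrivial) ∧
      (∀ i j, (w i).Equivalent (w j) → w i = w j) ∧ (∀ f ≠ 0, {i | w i f ≠ 1}.Finite) ∧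
      ∀ f ≠ 0, φ f = ∑ᶠ i, c i * (w i).val f := by
  have hpow : ∀ f ≠ 0, ∀ k : ℕ, φ (f ^ k) = k * φ f := fun f hf k => by
    induction k with
    | zero => simpa using hmul 1 1 one_ne_zero one_ne_zero
    | succ k ih =>
      rw [pow_succ, hmul _ _ (pow_ne_zero k hf) hf, ih]
      push_cast
      ring
  -- An integral `f` has a common denominator `r` for all its powers, so `φ r + k φ f ≥ 0` for every
  -- `k`.
  have hint : ∀ f ≠ 0, IsIntegral R f → 0 ≤ φ f := by
    intro f hf hfi
    obtain ⟨r, hr, h⟩ := hfi.isAlmostIntegral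
    have hr0 : r ≠ 0 := nonZeroDivisors.ne_zero hr
    have hr1 : algebraMap R F r ≠ 0 := fun h0 =>
      hr0 ((IsFractionRing.injective R F) (h0.trans (map_zero _).symm))
    have hk : ∀ k : ℕ, 0 ≤ φ (algebraMap R F r) + k * φ f := fun k => by
      obtain ⟨g, hg⟩ := h k
      have hg0 : g ≠ 0 := by
        rintro rfl
        rw [map_zero, Algebra.smul_def] at hg
        exact mul_ne_zero hr1 (pow_ne_zero k hf) hg.symm
      have := hnn g hg0
      rwa [hg, Algebra.smul_def, hmul _ _ hr1 (pow_ne_zero k hf), hpow f hf] at this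
    by_contra! hneg
    obtain ⟨k, hk'⟩ := exists_nat_gt (φ (algebraMap R F r) / -φ f)
    rw [div_lt_iff₀ (by linarith)] at hk'
    linarith [hk k]
  let _ : Algebra B F := ((algebraMap R F).comp (algebraMap B R)).toAlgebra
  have : IsScalarTower B R F := .of_algebraMap_eq' rfl
  have : FaithfulSMul B F := (faithfulSMul_iff_algebraMap_injective B F).2
    ((IsFractionRing.injective R F).comp (FaithfulSMul.algebraMap_injective B R))
  let E := FractionRing B
  let _ : Algebra E F := FractionRing.liftAlgebra B F
  have : IsScalarTower B E F := FractionRing.isScalarTower_liftAlgebra B F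
  have : Algebra.IsIntegral B R := inferInstance
  have : Algebra.IsAlgebraic B R := inferInstance
  have : FiniteDimensional E F := .of_isLocalization B R (nonZeroDivisors B)
  let L := separableClosure E F
  have : IsScalarTower B L F := .of_algebraMap_eq fun b => by
    rw [IsScalarTower.algebraMap_apply B E F, IsScalarTower.algebraMap_apply B E L]
    rfl
  let p := ringExpChar L
  have : ExpChar L p := inferInstance
  let ψ := IsPurelyInseparable.iterateFrobenius L F p (le_refl _)
  set q := p ^ IsPurelyInseparable.exponent L F with hq
  have hq0 : q ≠ 0 := pow_ne_zero _ (expChar_pos L p).ne'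
  have hψ : ∀ f : F, algebraMap L F (ψ f) = f ^ q :=
    IsPurelyInseparable.algebraMap_iterateFrobenius L p _
  have hψ' : ∀ f : L, ψ (algebraMap L F f) = f ^ q :=
    IsPurelyInseparable.iterateFrobenius_algebraMap F p _
  have hmap : ∀ {f : L}, f ≠ 0 → algebraMap L F f ≠ 0 := fun hf =>
    (map_ne_zero (algebraMap L F)).2 hf
  obtain ⟨ι, w, h1, h2, h3, h4⟩ :=
    exists_places_of_uniqueFactorizationMonoid (B := B) (E := E) (L := L)
  obtain ⟨c, hc, hφ⟩ := exists_weights_of_nonneg w h3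
    (by
      intro i
      obtain ⟨f, hf⟩ := (h2 i).2
      have : Algebra.IsAlgebraic B L := by
        have := IsLocalization.isAlgebraic E (nonZeroDivisors B)
        exact Algebra.IsAlgebraic.trans B E L
      obtain ⟨b, hb, hbf⟩ := Algebra.IsAlgebraic.exists_integral_multiples B {f}
      have hb0 : algebraMap B L b ≠ 0 := by
        have : Function.Injective (algebraMap B L) := by
          rw [IsScalarTower.algebraMap_eq B E L]
          exact (algebraMap E L).injective.comp (IsFractionRing.injective B E)
        exact fun h0 => hb (this (h0.trans (map_zero _).symm))
      refine ⟨algebraMap B L b, hb0, fun j => h1 j _ isIntegral_algebraMap, ?_⟩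
      have := h1 i _ (hbf f (by simp))
      rw [Algebra.smul_def, Place.mul, hf] at this
      have he : 1 < Real.exp 1 := Real.one_lt_exp_iff.2 one_pos
      nlinarith [(w i).pos_of_ne_zero hb0])
    (fun f => φ (algebraMap L F f))
    (fun f g hf hg => by rw [map_mul]; exact hmul _ _ (hmap hf) (hmap hg))
    (fun f hf h => hint _ (hmap hf) ((h4 f h).algebraMap.tower_top))
  refine ⟨ι, fun i => (w i).comap ψ, fun i => c i / q, fun i => div_nonneg (hc i) q.cast_nonneg,
    fun i f => ?_, fun i htriv => ?_, fun i j hij => ?_, fun f hf => ?_, fun f hf => ?_⟩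
  · refine h1 i _ ?_
    rw [← isIntegral_algebraMap_iff (algebraMap L F).injective (B := F), hψ]
    exact ((Algebra.IsIntegral.isIntegral f).algebraMap).pow q
  · obtain ⟨f, hf⟩ := (h2 i).2
    have hf0 : f ≠ 0 := by
      rintro rfl
      rw [Place.zero] at hf
      exact (Real.exp_pos 1).ne hf
    have := htriv (algebraMap L F f) (hmap hf0)
    change w i (ψ (algebraMap L F f)) = 1 at this
    rw [hψ', Place.map_pow, hf, pow_eq_one_iff_of_nonneg (Real.exp_pos 1).le hq0] at this
    exact (Real.one_lt_exp_iff.2 one_pos).ne' this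
  · obtain ⟨s, hs, h⟩ := hij
    have : (w i).Equivalent (w j) := ⟨s, hs, fun a => by
      have := h (algebraMap L F a)
      change w j (ψ _) = w i (ψ _) ^ s at this
      rw [hψ', Place.map_pow, Place.map_pow] at this
      refine (pow_left_inj₀ ((w j).nonneg a) (Real.rpow_nonneg ((w i).nonneg a) s) hq0).1 ?_
      rw [this, ← Real.rpow_natCast, ← Real.rpow_natCast, ← Real.rpow_mul ((w i).nonneg a),
        ← Real.rpow_mul ((w i).nonneg a), mul_comm]⟩
    change (w i).comap ψ = (w j).comap ψ
    rw [(h2 i).eq_of_equivalent (h2 j) this]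
  · exact h3 (ψ f) ((map_ne_zero ψ).2 hf)
  · have := hφ (ψ f) ((map_ne_zero ψ).2 hf)
    simp only [hψ] at this
    rw [hpow f hf] at this
    have hq1 : (q : ℝ) ≠ 0 := Nat.cast_ne_zero.2 hq0
    rw [← mul_right_inj' hq1, this, mul_finsum]
    refine finsum_congr fun i => ?_
    rw [← mul_assoc, mul_div_cancel₀ _ hq1]
    rfl

/-- A homomorphism on the multiplicative group of the fraction field of a finitely generated domain `R`
over `K`, nonnegative on `R`, is a nonnegative combination of discrete places bounded on `R`. -/
theorem exists_divisorial_representation {K : Type uB} {R : Type uE} {F : Type uL} [Field K]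
    [CommRing R] [IsDomain R] [Field F] [Algebra K R] [Algebra.FiniteType K R] [Algebra R F]
    [IsFractionRing R F] (φ : F → ℝ) (hmul : ∀ f g, f ≠ 0 → g ≠ 0 → φ (f * g) = φ f + φ g)
    (hnn : ∀ f : R, f ≠ 0 → 0 ≤ φ (algebraMap R F f)) :
    ∃ (ι : Type max uB uL) (w : ι → Place F) (c : ι → ℝ), (∀ i, 0 ≤ c i) ∧
      (∀ i (f : R), w i (algebraMap R F f) ≤ 1) ∧ (∀ i, ¬ (w i).IsTrivial) ∧
      (∀ i j, (w i).Equivalent (w j) → w i = w j) ∧ (∀ f ≠ 0, {i | w i f ≠ 1}.Finite) ∧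
      ∀ f ≠ 0, φ f = ∑ᶠ i, c i * (w i).val f := by
  -- Noether normalization provides the factorial Noetherian base ring.
  obtain ⟨s, g, hg, hfin⟩ := exists_finite_inj_algHom_of_fg K R
  let _ : Algebra (MvPolynomial (Fin s) K) R := g.toRingHom.toAlgebra
  have : Module.Finite (MvPolynomial (Fin s) K) R := hfin
  have : FaithfulSMul (MvPolynomial (Fin s) K) R :=
    (faithfulSMul_iff_algebraMap_injective _ _).2 hg
  exact exists_divisorial_representation_of_finite (B := MvPolynomial (Fin s) K) φ hmul hnn

/-! ### Measures on fibred spaces from positive functionals -/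

section Fibred

variable {T Y : Type*} [MeasurableSpace T]

/-- The functions on `Z` that are dominated by an integrable function on the base. -/
def baseDominated (μ : Measure T) (π : Y → T) (Z : Set Y) : Submodule ℝ (Z → ℝ) where
  carrier := {e | ∃ b : T → ℝ, Integrable b μ ∧ ∀ v : Z, |e v| ≤ b (π v)}
  add_mem' := by
    rintro e e' ⟨b, hb, h⟩ ⟨b', hb', h'⟩
    exact ⟨b + b', hb.add hb', fun v => (abs_add_le _ _).trans (add_le_add (h v) (h' v))⟩
  zero_mem' := ⟨0, integrable_zero _ _ _, fun v => by simp⟩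
  smul_mem' := by
    rintro r e ⟨b, hb, h⟩
    refine ⟨fun p => |r| * b p, hb.const_mul _, fun v => ?_⟩
    rw [Pi.smul_apply, smul_eq_mul, abs_mul]
    exact mul_le_mul_of_nonneg_left (h v) (abs_nonneg r)

variable {μ : Measure T} {π : Y → T} {Z : Set Y}

theorem comp_mem_baseDominated {h : T → ℝ} (hh : Integrable h μ) :
    (fun v : Z => h (π v)) ∈ baseDominated μ π Z :=
  ⟨fun p => |h p|, hh.abs, fun _ => le_rfl⟩

/-- A functional is *compatible* with `μ` if it is positive on dominated functions and restricts to
integration against `μ` on the functions coming from the base. -/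
structure IsCompatible (μ : Measure T) (π : Y → T) (Z : Set Y) (Λ : (Z → ℝ) →ₗ[ℝ] ℝ) : Prop where
  nonneg : ∀ e ∈ baseDominated μ π Z, (∀ v, 0 ≤ e v) → 0 ≤ Λ e
  base : ∀ h : T → ℝ, Integrable h μ → Λ (fun v => h (π v)) = ∫ p, h p ∂μ

variable [TopologicalSpace Y]

theorem indicator_mul_mem_baseDominated {C E : Set T} (hE : MeasurableSet E) (hEC : E ⊆ C)
    (hμ : μ E ≠ ⊤) (hZ : IsCompact (Z ∩ π ⁻¹' C)) {g : Y → ℝ}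
    (hg : ContinuousOn g (Z ∩ π ⁻¹' C)) :
    (fun v : Z => E.indicator 1 (π v) * g v) ∈ baseDominated μ π Z := by
  obtain ⟨M, hM⟩ := hZ.exists_bound_of_continuousOn hg
  refine ⟨E.indicator fun _ => M, (integrable_indicator_iff hE).2 (integrableOn_const hμ),
    fun v => ?_⟩
  by_cases h : π v ∈ E
  · simpa [h] using hM v ⟨v.2, hEC h⟩
  · simp [h]

/-- Riesz representation on the compact set above `C`. The separate set `E` allows the disjoint
pieces used later, which need not be compact themselves. -/
theorem IsCompatible.exists_measure [T2Space Y] [MeasurableSpace Y] [BorelSpace Y] {Λ : (Z → ℝ) →ₗ[ℝ] ℝ} (hΛ : IsCompatible μ π Z Λ)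
    {C E : Set T} (hE : MeasurableSet E) (hEC : E ⊆ C)
    (hμ : μ E ≠ ⊤) (hZ : IsCompact (Z ∩ π ⁻¹' C)) :
    ∃ ν : Measure Y, IsFiniteMeasure ν ∧ ν (Z ∩ π ⁻¹' C)ᶜ = 0 ∧ ∀ g : Y → ℝ, Continuous g →
      Integrable g ν ∧ ∫ v, g v ∂ν = Λ (fun v => E.indicator 1 (π v) * g v) := by
  classical
  set W := Z ∩ π ⁻¹' C with hW
  have : CompactSpace W := isCompact_iff_compactSpace.1 hZ
  let ext : (W → ℝ) →ₗ[ℝ] (Z → ℝ) :=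
    { toFun := fun g v => if h : π v ∈ C then E.indicator 1 (π v) * g ⟨v, v.2, h⟩ else 0
      map_add' := fun g g' => by
        funext v
        simp only [Pi.add_apply]
        split_ifs <;> ring
      map_smul' := fun r g => by
        funext v
        simp only [Pi.smul_apply, smul_eq_mul, RingHom.id_apply]
        split_ifs <;> ring }
  have hdom : ∀ g : W → ℝ, Continuous g → ext g ∈ baseDominated μ π Z := fun g hg => by
    obtain ⟨M, hM⟩ := isCompact_univ.exists_bound_of_continuousOn (s := Set.univ) hg.continuousOn
    refine ⟨E.indicator fun _ => M, (integrable_indicator_iff hE).2 (integrableOn_const hμ),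
      fun v => ?_⟩
    by_cases h : π v ∈ E
    · simpa [ext, h, hEC h] using hM ⟨v, v.2, hEC h⟩ trivial
    · simp [ext, h]
  let Ψ : CompactlySupportedContinuousMap W ℝ →ₚ[ℝ] ℝ := PositiveLinearMap.mk₀
    { toFun := fun g => Λ (ext g)
      map_add' := fun g g' => by
        rw [← map_add, ← map_add]
        rfl
      map_smul' := fun r g => by
        rw [RingHom.id_apply, ← map_smul, ← map_smul]
        rfl }
    fun g hg => hΛ.nonneg _ (hdom g g.continuous) fun v => by
      change 0 ≤ dite _ _ _
      split_ifs with h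
      · exact mul_nonneg (Set.indicator_nonneg (fun _ _ => zero_le_one) _) (hg _)
      · exact le_rfl
  have := RealRMK.regular_rieszMeasure Ψ
  have : IsFiniteMeasure (RealRMK.rieszMeasure Ψ) := CompactSpace.isFiniteMeasure
  have hemb : MeasurableEmbedding (Subtype.val : W → Y) :=
    MeasurableEmbedding.subtype_coe hZ.measurableSet
  refine ⟨(RealRMK.rieszMeasure Ψ).map Subtype.val, inferInstance, ?_, fun g hg => ⟨?_, ?_⟩⟩
  · rw [hemb.map_apply]
    simp
  · rw [hemb.integrable_map_iff]
    exact (hg.comp continuous_subtype_val).integrable_of_hasCompactSupport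
      (HasCompactSupport.of_compactSpace _)
  · rw [hemb.integral_map]
    have := RealRMK.integral_rieszMeasure Ψ
      ⟨⟨fun v : W => g v, hg.comp continuous_subtype_val⟩, HasCompactSupport.of_compactSpace _⟩
    refine this.trans (congrArg Λ ?_)
    funext v
    change dite _ _ _ = _
    split_ifs with h
    · rfl
    · rw [Set.indicator_of_notMem fun h' => h (hEC h'), zero_mul]

end Fibred

/-! ### A functional subject to the product inequality -/

/-- The separation lemma is applied to the constraints `Λ e ≥ ∫ h` whenever `e ≥ h - v(f)` on `Z`;
`hneg` is their consistency at `e = 0`. Taking `f = 1` gives positivity and the values on the base,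
while `h = 0` gives the last clause. -/
theorem exists_isCompatible {K R : Type*} [Field K] [CommRing R] [IsDomain R] [Algebra K R]
    {μ : Measure (Place K)} {Z : Set (Place R)}
    (hneg : ∀ f : R, f ≠ 0 → ∀ h : Place K → ℝ, Integrable h μ →
      (∀ v ∈ Z, v f ≤ Real.exp (-h (v.res K))) → ∫ p, h p ∂μ ≤ 0) :
    ∃ Λ : (Z → ℝ) →ₗ[ℝ] ℝ, IsCompatible μ (Place.res K) Z Λ ∧
      ∀ f : R, f ≠ 0 → ∀ e ∈ baseDominated μ (Place.res K) Z,
        (∀ v : Z, v.1 f ≤ Real.exp (-e v)) → Λ e ≤ 0 := by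
  let 𝓛 := baseDominated μ (Place.res K) Z
  let Γ : AddSubmonoid (𝓛 × ℝ) :=
    { carrier := {x | ∃ f : R, f ≠ 0 ∧ ∃ h : Place K → ℝ, Integrable h μ ∧
        (∀ v : Z, v.1 f ≤ Real.exp (x.1.1 v - h (v.1.res K))) ∧ -∫ p, h p ∂μ ≤ x.2}
      add_mem' := by
        rintro x y ⟨f, hf, h, hh, hv, ht⟩ ⟨f', hf', h', hh', hv', ht'⟩
        refine ⟨f * f', mul_ne_zero hf hf', h + h', hh.add hh', fun v => ?_, ?_⟩
        · rw [Place.mul]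
          refine (mul_le_mul (hv v) (hv' v) (v.1.nonneg _) (Real.exp_pos _).le).trans_eq ?_
          rw [← Real.exp_add]
          congr 1
          simp only [Prod.fst_add, Submodule.coe_add, Pi.add_apply]
          ring
        · rw [Prod.snd_add, integral_add' hh hh']
          linarith
      zero_mem' := ⟨1, one_ne_zero, 0, integrable_zero _ _ _, fun v => by simp [Place.one],
        by simp⟩ }
  obtain ⟨Λ, hΛ⟩ := exists_linearMap_of_constraints Γ
    (by
      rintro e t t' htt ⟨f, hf, h, hh, hv, ht⟩
      exact ⟨f, hf, h, hh, hv, ht.trans htt⟩)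
    (by
      rintro t ⟨f, hf, h, hh, hv, ht⟩
      have := hneg f hf h hh fun v hv' => by simpa using hv ⟨v, hv'⟩
      simp only at ht
      linarith)
    (by
      rintro ⟨e, b, hb, he⟩
      refine ⟨∫ p, b p ∂μ, fun r hr hr1 => ⟨1, one_ne_zero, fun p => -b p, hb.neg, fun v => ?_, ?_⟩⟩
      · rw [Place.one, Real.one_le_exp_iff]
        have h1 := he v
        have h2 := neg_abs_le (e v)
        change 0 ≤ r * e v - -b (v.1.res K)
        nlinarith [abs_nonneg (e v)]
      · rw [integral_neg, neg_neg])
  -- The extension to all functions is arbitrary; only its values on dominated functions carry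
  -- information.
  obtain ⟨Λ', hΛ'⟩ := LinearMap.exists_extend Λ
  have hext : ∀ e (he : e ∈ 𝓛), Λ' e = Λ ⟨e, he⟩ := fun e he => by rw [← hΛ']; rfl
  refine ⟨Λ', ⟨fun e he hnn => ?_, fun h hh => ?_⟩, fun f hf e he hv => ?_⟩
  · rw [hext e he]
    have := hΛ ⟨e, he⟩ 0 ⟨1, one_ne_zero, 0, integrable_zero _ _ _, fun v => ?_, by simp⟩
    · simpa using this
    · simpa [Place.one] using hnn v
  · have hm : (fun v : Z => h (v.1.res K)) ∈ 𝓛 := comp_mem_baseDominated hh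
    rw [hext _ hm]
    have h1 := hΛ ⟨_, hm⟩ (-∫ p, h p ∂μ) ⟨1, one_ne_zero, h, hh, fun v => by simp [Place.one],
      le_rfl⟩
    have h2 := hΛ (-⟨_, hm⟩) (∫ p, h p ∂μ) ⟨1, one_ne_zero, -h, hh.neg,
      fun v => by simp [Place.one], by simp [integral_neg]⟩
    rw [map_neg] at h2
    linarith
  · rw [hext e he]
    have := hΛ (-⟨e, he⟩) 0 ⟨f, hf, 0, integrable_zero _ _ _, fun v => by simpa using hv v, by simp⟩
    rw [map_neg] at this
    linarith

/-! ### From the functional to a measure satisfying the product inequality. -/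

section ProductInequality

variable {K R : Type*} [Field K] [CommRing R] [Algebra K R]

theorem Place.continuous_res : Continuous (Place.res K : Place R → Place K) :=
  Place.continuous_comap _

theorem Place.measurable_res : Measurable (Place.res K : Place R → Place K) :=
  Place.continuous_res.measurable

/-- The truncation of `v f` at `N`. -/
noncomputable def truncOrd (f : R) (N : ℕ) (v : Place R) : ℝ :=
  -Real.log (max (v f) (Real.exp (-N)))

theorem continuous_truncOrd (f : R) (N : ℕ) : Continuous (truncOrd f N) :=
  (Continuous.log ((Place.continuous_apply f).max continuous_const) fun _ =>
    (lt_max_of_lt_right (Real.exp_pos _)).ne').neg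

theorem truncOrd_mono (f : R) (v : Place R) : Monotone fun N => truncOrd f N v := by
  intro M N hMN
  refine neg_le_neg (Real.log_le_log (lt_max_of_lt_right (Real.exp_pos _))
    (max_le_max le_rfl (Real.exp_le_exp.2 ?_)))
  simpa using hMN

theorem apply_le_exp_neg_truncOrd (f : R) (N : ℕ) (v : Place R) :
    v f ≤ Real.exp (-truncOrd f N v) := by
  rw [truncOrd, neg_neg, Real.exp_log (lt_max_of_lt_right (Real.exp_pos _))]
  exact le_max_left _ _

theorem ofReal_neg_truncOrd_le (f : R) (N : ℕ) (v : Place R) :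
    ENNReal.ofReal (-truncOrd f N v) ≤ ENNReal.ofReal (Real.log (v f)) := by
  rw [truncOrd, neg_neg]
  rcases le_total (v f) (Real.exp (-N)) with h | h
  · rw [max_eq_right h, Real.log_exp, ENNReal.ofReal_of_nonpos (by simp)]
    exact zero_le
  · rw [max_eq_left h]

theorem truncOrd_eq_of_le {f : R} {N : ℕ} {v : Place R} (h : Real.exp (-N) ≤ v f) :
    truncOrd f N v = -Real.log (v f) := by
  rw [truncOrd, max_eq_left h]

theorem truncOrd_eq_of_eq_zero {f : R} {v : Place R} (h : v f = 0) (N : ℕ) :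
    truncOrd f N v = N := by
  rw [truncOrd, h, max_eq_right (Real.exp_pos _).le, Real.log_exp, neg_neg]

/-- The supremum of truncations is `+∞` where `f` vanishes, whereas `Real.log 0 = 0`. Its finite
integral therefore excludes vanishing on a set of positive measure, and then bounds the negative
part of the logarithm. -/
theorem integrable_log_of_iSup_truncOrd_le {ν : Measure (Place R)} {f : R}
    (hfin : ∫⁻ v, ENNReal.ofReal (Real.log (v f)) ∂ν ≠ ⊤)
    (hle : ∫⁻ v, ⨆ N, ENNReal.ofReal (truncOrd f N v) ∂ν
      ≤ ∫⁻ v, ENNReal.ofReal (Real.log (v f)) ∂ν) :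
    (∀ᵐ v ∂ν, v f ≠ 0) ∧ Integrable (fun v => Real.log (v f)) ν ∧
      0 ≤ ∫ v, Real.log (v f) ∂ν := by
  have hmeas : Measurable fun v : Place R => ⨆ N, ENNReal.ofReal (truncOrd f N v) :=
    .iSup fun N => (continuous_truncOrd f N).measurable.ennreal_ofReal
  have hne : ∀ᵐ v ∂ν, v f ≠ 0 := by
    filter_upwards [ae_lt_top hmeas (ne_top_of_le_ne_top hfin hle)] with v hv h0
    refine hv.ne (ENNReal.eq_top_of_forall_nnreal_le fun r => ?_)
    obtain ⟨N, hN⟩ := exists_nat_ge (r : ℝ)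
    refine le_trans ?_ (le_iSup _ N)
    rw [truncOrd_eq_of_eq_zero h0, ENNReal.ofReal_natCast]
    exact_mod_cast hN
  have hlog : AEStronglyMeasurable (fun v : Place R => Real.log (v f)) ν :=
    (Real.measurable_log.comp (Place.measurable_apply f)).aestronglyMeasurable
  have hneg : ∫⁻ v, ENNReal.ofReal (-Real.log (v f)) ∂ν
      ≤ ∫⁻ v, ENNReal.ofReal (Real.log (v f)) ∂ν := by
    refine le_trans (lintegral_mono_ae ?_) hle
    filter_upwards [hne] with v hv
    have hpos : 0 < v f := (v.nonneg f).lt_of_ne' hv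
    obtain ⟨N, hN⟩ := exists_nat_ge (-Real.log (v f))
    refine le_trans (le_of_eq ?_) (le_iSup _ N)
    rw [truncOrd_eq_of_le]
    rw [← Real.le_log_iff_exp_le hpos]
    linarith
  have hint : Integrable (fun v : Place R => Real.log (v f)) ν := by
    refine ⟨hlog, ?_⟩
    rw [hasFiniteIntegral_iff_norm]
    have : ∀ v : Place R, ENNReal.ofReal ‖Real.log (v f)‖ =
        ENNReal.ofReal (Real.log (v f)) + ENNReal.ofReal (-Real.log (v f)) := fun v => by
      rcases le_total 0 (Real.log (v f)) with h | h
      · rw [Real.norm_of_nonneg h, ENNReal.ofReal_of_nonpos (neg_nonpos.2 h), add_zero]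
      · rw [Real.norm_of_nonpos h, ENNReal.ofReal_of_nonpos h, zero_add]
    simp_rw [this]
    have hm : Measurable fun v : Place R => ENNReal.ofReal (Real.log (v f)) :=
      (Real.measurable_log.comp (Place.measurable_apply f)).ennreal_ofReal
    rw [lintegral_add_left hm]
    exact ENNReal.add_lt_top.2 ⟨hfin.lt_top, (ne_top_of_le_ne_top hfin hneg).lt_top⟩
  refine ⟨hne, hint, ?_⟩
  rw [integral_eq_lintegral_pos_part_sub_lintegral_neg_part hint, sub_nonneg]
  exact ENNReal.toReal_mono hfin hneg

/-- The measures over disjoint base pieces are summed. Since `v(f)` may be unbounded or infinite,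
the inequality is proved for truncations over finitely many pieces and passed to the limit by
monotone convergence. -/
theorem exists_measure_of_product_inequality [IsDomain R] [Countable K]
    {μ : Measure (Place K)} {Z : Set (Place R)} (hZ : MeasurableSet Z)
    (hbound : ∀ f : R, ∃ H : Place K → ℝ, Integrable H μ ∧ (∀ p, 0 ≤ H p) ∧
      ∀ v ∈ Z, v f ≤ Real.exp (H (v.res K)))
    (C : ℕ → Set (Place K)) (hC : ∀ j, MeasurableSet (C j)) (hCμ : ∀ j, μ (C j) ≠ ⊤)
    (hCZ : ∀ j, IsCompact (Z ∩ Place.res K ⁻¹' C j)) (hcover : ∀ᵐ p ∂μ, p ∈ ⋃ j, C j)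
    (hneg : ∀ f : R, f ≠ 0 → ∀ h : Place K → ℝ, Integrable h μ →
      (∀ v ∈ Z, v f ≤ Real.exp (-h (v.res K))) → ∫ p, h p ∂μ ≤ 0) :
    ∃ ν : Measure (Place R), ν.map (Place.res K) = μ ∧ (∀ᵐ v ∂ν, v ∈ Z) ∧
      ∀ f : R, f ≠ 0 → (∀ᵐ v ∂ν, v f ≠ 0) ∧ Integrable (fun v => Real.log (v f)) ν ∧
        0 ≤ ∫ v, Real.log (v f) ∂ν := by
  obtain ⟨Λ, hΛ, hΛneg⟩ := exists_isCompatible hneg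
  let E := disjointed C
  have hEm : ∀ j, MeasurableSet (E j) := fun j => .disjointed hC j
  have hEC : ∀ j, E j ⊆ C j := disjointed_subset C
  have hEμ : ∀ j, μ (E j) ≠ ⊤ := fun j => ne_top_of_le_ne_top (hCμ j) (measure_mono (hEC j))
  have hEd : Pairwise (Function.onFun Disjoint E) := disjoint_disjointed C
  have hEU : ∀ᵐ p ∂μ, p ∈ ⋃ j, E j := by rwa [iUnion_disjointed]
  choose ν hνfin hνZ hν using fun j => hΛ.exists_measure (hEm j) (hEC j) (hEμ j) (hCZ j)
  have hmap : ∀ j, (ν j).map (Place.res K) = μ.restrict (E j) := fun j => by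
    have : IsFiniteMeasure (μ.restrict (E j)) := ⟨by simpa using (hEμ j).lt_top⟩
    refine ext_of_forall_integral_eq_of_IsFiniteMeasure fun g => ?_
    rw [integral_map Place.measurable_res.aemeasurable g.continuous.aestronglyMeasurable,
      (hν j (fun v => g (v.res K)) (g.continuous.comp Place.continuous_res)).2, ← integral_indicator (hEm j),
      ← hΛ.base]
    · congr 1
      funext v
      by_cases h : v.1.res K ∈ E j <;> simp [h]
    · rw [integrable_indicator_iff (hEm j)]
      exact g.integrable _
  have hνmap : (Measure.sum ν).map (Place.res K) = μ := by
    rw [Measure.map_sum Place.measurable_res.aemeasurable]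
    simp_rw [hmap]
    rw [← Measure.restrict_iUnion hEd hEm, Measure.restrict_eq_self_of_ae_mem hEU]
  have hνmem : ∀ᵐ v ∂Measure.sum ν, v ∈ Z := by
    rw [ae_iff]
    have : MeasurableSet {v | v ∉ Z} := hZ.compl
    rw [Measure.sum_apply _ this, ENNReal.tsum_eq_zero]
    exact fun j => measure_mono_null (Set.compl_subset_compl.2 Set.inter_subset_left) (hνZ j)
  refine ⟨Measure.sum ν, hνmap, hνmem, fun f hf => ?_⟩
  obtain ⟨H, hHint, hH0, hH⟩ := hbound f
  set P := ∫⁻ v, ENNReal.ofReal (Real.log (v f)) ∂Measure.sum ν with hP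
  have hlogH : ∀ v ∈ Z, Real.log (v f) ≤ H (v.res K) := fun v hv => by
    rcases (v.nonneg f).eq_or_lt with h | h
    · rw [← h, Real.log_zero]
      exact hH0 _
    · exact (Real.log_le_iff_le_exp h).2 (hH v hv)
  have hPfin : P ≠ ⊤ := by
    have h1 : P ≤ ∫⁻ v, ENNReal.ofReal (H (v.res K)) ∂Measure.sum ν := by
      refine lintegral_mono_ae ?_
      filter_upwards [hνmem] with v hv
      exact ENNReal.ofReal_le_ofReal (hlogH v hv)
    have h2 : Integrable (fun v : Place R => H (v.res K)) (Measure.sum ν) := by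
      have : Integrable H ((Measure.sum ν).map (Place.res K)) := by rwa [hνmap]
      exact this.comp_measurable Place.measurable_res
    exact ne_top_of_le_ne_top h2.lintegral_lt_top.ne h1
  let U : ℕ → Set (Place K) := fun N => ⋃ j ∈ Finset.range N, E j
  have hUm : ∀ N, MeasurableSet (U N) := fun N =>
    Finset.measurableSet_biUnion _ fun j _ => hEm j
  -- The price of ignoring all but the first `N` pieces: there `v(f)` is only known to be at least
  -- `-H`.
  let δ : ℕ → ℝ := fun N => ∫ p in (U N)ᶜ, H p ∂μ
  have hδ : Tendsto δ atTop (nhds 0) := by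
    have h1 := Antitone.tendsto_setIntegral (μ := μ) (f := H) (fun N => (hUm N).compl)
      (fun M N hMN => Set.compl_subset_compl.2 (Set.biUnion_subset_biUnion_left fun j hj =>
        Finset.range_mono hMN hj)) hHint.integrableOn
    have h2 : μ (⋂ N, (U N)ᶜ) = 0 := by
      refine measure_mono_null (fun p hp => ?_) hEU
      rw [Set.mem_iInter] at hp
      intro hp'
      obtain ⟨j, hj⟩ := Set.mem_iUnion.1 hp'
      exact hp (j + 1) (Set.mem_biUnion (Finset.self_mem_range_succ j) hj)
    rwa [Measure.restrict_eq_zero.2 h2, integral_zero_measure] at h1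
  let νN : ℕ → Measure (Place R) := fun N => ∑ j ∈ Finset.range N, ν j
  have hνN_le : ∀ N (q : Place R → ENNReal), ∫⁻ v, q v ∂νN N ≤ ∫⁻ v, q v ∂Measure.sum ν := by
    intro N q
    rw [lintegral_finsetSum_measure, lintegral_sum_measure]
    exact ENNReal.sum_le_tsum _
  have hind : ∀ N (p : Place K), ∑ j ∈ Finset.range N, (E j).indicator (1 : Place K → ℝ) p =
      (U N).indicator 1 p := by
    intro N p
    by_cases hp : p ∈ U N
    · obtain ⟨j, hj, hpj⟩ := Set.mem_iUnion₂.1 hp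
      rw [Finset.sum_eq_single_of_mem j hj fun i _ hij => Set.indicator_of_notMem
        (fun hi => Set.disjoint_left.1 (hEd hij) hi hpj) _, Set.indicator_of_mem hpj,
        Set.indicator_of_mem hp]
    · rw [Set.indicator_of_notMem hp]
      refine Finset.sum_eq_zero fun j hj => Set.indicator_of_notMem (fun h => hp ?_) _
      exact Set.mem_biUnion hj h
  have hdomN : ∀ N j, (fun v : Z => (E j).indicator 1 (v.1.res K) * truncOrd f N v.1) ∈
      baseDominated μ (Place.res K) Z := fun N j =>
    indicator_mul_mem_baseDominated (hEm j) (hEC j) (hEμ j) (hCZ j)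
      (continuous_truncOrd f N).continuousOn
  have hintN : ∀ N, Integrable (truncOrd f N) (νN N) ∧ ∫ v, truncOrd f N v ∂νN N ≤ δ N := by
    intro N
    have hi : ∀ j ∈ Finset.range N, Integrable (truncOrd f N) (ν j) := fun j _ =>
      (hν j _ (continuous_truncOrd f N)).1
    refine ⟨integrable_finsetSum_measure.2 hi, ?_⟩
    rw [integral_finsetSum_measure hi]
    simp_rw [fun j => (hν j _ (continuous_truncOrd f N)).2]
    have hHoff : Integrable ((U N)ᶜ.indicator H) μ := hHint.indicator (hUm N).compl
    have hδeq : δ N = Λ (fun v => (U N)ᶜ.indicator H (v.1.res K)) := by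
      rw [hΛ.base _ hHoff, integral_indicator (hUm N).compl]
    rw [hδeq, ← sub_nonpos, ← map_sum, ← map_sub]
    -- The test function is the truncation of `v(f)` above `U N` and `-H` elsewhere; it lies below
    -- `v(f)` on all of `Z`.
    refine hΛneg f hf _ (Submodule.sub_mem _ (Submodule.sum_mem _ fun j _ => hdomN N j)
      (comp_mem_baseDominated hHoff)) fun v => ?_
    rw [Pi.sub_apply, Finset.sum_apply, ← Finset.sum_mul, hind]
    by_cases hv : v.1.res K ∈ U N
    · rw [Set.indicator_of_mem hv, Set.indicator_of_notMem (Set.notMem_compl_iff.2 hv), sub_zero,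
        Pi.one_apply, one_mul]
      exact apply_le_exp_neg_truncOrd f N v.1
    · rw [Set.indicator_of_notMem hv, Set.indicator_of_mem (s := (U N)ᶜ) hv, zero_mul, zero_sub,
        neg_neg]
      exact hH v.1 v.2
  have hposN : ∀ N, ∫⁻ v, ENNReal.ofReal (truncOrd f N v) ∂νN N ≤ P + ENNReal.ofReal (δ N) := by
    intro N
    obtain ⟨hi, hle⟩ := hintN N
    have hn : ∫⁻ v, ENNReal.ofReal (-truncOrd f N v) ∂νN N ≤ P :=
      (lintegral_mono fun v => ofReal_neg_truncOrd_le f N v).trans (hνN_le N _)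
    rw [integral_eq_lintegral_pos_part_sub_lintegral_neg_part hi] at hle
    have h2 := ENNReal.toReal_mono hPfin hn
    rw [← ENNReal.ofReal_toReal hi.lintegral_lt_top.ne, ← ENNReal.ofReal_toReal hPfin,
      ← ENNReal.ofReal_add ENNReal.toReal_nonneg (setIntegral_nonneg (hUm N).compl fun p _ => hH0 p)]
    exact ENNReal.ofReal_le_ofReal (by linarith)
  have hmonoN : ∀ {M N} (_ : M ≤ N) (q : Place R → ENNReal),
      ∫⁻ v, q v ∂νN M ≤ ∫⁻ v, q v ∂νN N := by
    intro M N hMN q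
    rw [lintegral_finsetSum_measure, lintegral_finsetSum_measure]
    exact Finset.sum_le_sum_of_subset (Finset.range_mono hMN)
  -- With truncation level and number of pieces fixed at `M`, the bound at any larger `N` applies by
  -- monotonicity, and `δ N` tends to `0`.
  have hlim : ∀ M, ∫⁻ v, ENNReal.ofReal (truncOrd f M v) ∂νN M ≤ P := by
    intro M
    have ht : Tendsto (fun N => P + ENNReal.ofReal (δ N)) atTop (nhds (P + ENNReal.ofReal 0)) :=
      tendsto_const_nhds.add (ENNReal.tendsto_ofReal hδ)
    rw [ENNReal.ofReal_zero, add_zero] at ht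
    refine ge_of_tendsto ht ((eventually_ge_atTop M).mono fun N hMN => ?_)
    refine le_trans ?_ (hposN N)
    exact (lintegral_mono fun v => ENNReal.ofReal_le_ofReal (truncOrd_mono f v hMN)).trans
      (hmonoN hMN _)
  refine integrable_log_of_iSup_truncOrd_le hPfin ?_
  rw [lintegral_sum_measure]
  refine ENNReal.tsum_le_of_sum_range_le fun M => ?_
  rw [← lintegral_finsetSum_measure, lintegral_iSup
    (fun N => (continuous_truncOrd f N).measurable.ennreal_ofReal)
    fun N N' h v => ENNReal.ofReal_le_ofReal (truncOrd_mono f v h)]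
  refine iSup_le fun N => ?_
  refine le_trans ?_ (hlim (max M N))
  exact (lintegral_mono fun v => ENNReal.ofReal_le_ofReal
    (truncOrd_mono f v (le_max_right M N))).trans (hmonoN (le_max_left M N) _)

end ProductInequality

/-! ### The measure of a globally valued field -/

theorem Place.continuous_val {K : Type*} [Field K] {a : K} (ha : a ≠ 0) :
    Continuous fun v : Place K => v.val a :=
  ((Place.continuous_apply a).log fun v => (v.pos_of_ne_zero ha).ne').neg

theorem Place.measurable_val {K : Type*} [Field K] (a : K) :
    Measurable fun v : Place K => v.val a :=
  (Real.measurable_log.comp (Place.measurable_apply a)).neg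

theorem Place.exists_val_ne_zero {K : Type*} [Field K] {v : Place K} (hv : ¬ v.IsTrivial) :
    ∃ a : K, a ≠ 0 ∧ v.val a ≠ 0 := by
  rw [Place.IsTrivial] at hv
  push Not at hv
  obtain ⟨a, ha, h⟩ := hv
  exact ⟨a, ha, (v.val_ne_zero_iff ha).2 h⟩

namespace GVF

variable {K : Type*} [Field K] (G : GVF K)

theorem ae_mem_reps : ∀ᵐ v ∂G.measure, v ∈ G.reps := G.concentrated

/-- The sets where `|v(a)|` exceeds `1 / (k + 1)` have finite measure; countably many of them cover
all nontrivial places. -/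
theorem sigmaFinite [Countable K] : SigmaFinite G.measure := by
  refine Measure.sigmaFinite_of_countable (S := {G.repsᶜ} ∪ Set.range fun q : {a : K // a ≠ 0} × ℕ =>
    {v : Place K | 1 / ((q.2 : ℝ) + 1) < ‖v.val q.1.1‖})
    ((Set.countable_singleton _).union (Set.countable_range _)) ?_ ?_
  · rintro s (rfl | ⟨⟨⟨a, ha⟩, k⟩, rfl⟩)
    · rw [G.concentrated]
      exact ENNReal.zero_lt_top
    · exact (G.integrable a ha).measure_norm_gt_lt_top Nat.one_div_pos_of_nat
  · refine Set.eq_univ_of_forall fun v => ?_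
    by_cases hv : v ∈ G.reps
    · obtain ⟨a, ha, h⟩ := Place.exists_val_ne_zero (G.nontrivial v hv)
      obtain ⟨k, hk⟩ := exists_nat_one_div_lt (norm_pos_iff.2 h)
      exact Set.mem_sUnion.2 ⟨_, Or.inr ⟨⟨⟨a, ha⟩, k⟩, rfl⟩, hk⟩
    · exact Set.mem_sUnion.2 ⟨_, Or.inl rfl, hv⟩

/-- Near a nontrivial place some `|v(a)|` stays bounded away from `0`, so its integrability gives a
neighbourhood of finite measure. -/
theorem measure_lt_top_of_isCompact {S : Set (Place K)} (hS : IsCompact S) (hSG : S ⊆ G.reps) :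
    G.measure S < ⊤ := by
  refine hS.measure_lt_top_of_nhdsWithin fun p hp => ?_
  obtain ⟨a, ha, h⟩ := Place.exists_val_ne_zero (G.nontrivial p (hSG hp))
  have hpos : 0 < ‖p.val a‖ := norm_pos_iff.2 h
  refine ⟨{v | ‖p.val a‖ / 2 < ‖v.val a‖}, mem_nhdsWithin_of_mem_nhds ?_,
    (G.integrable a ha).measure_norm_gt_lt_top (by positivity)⟩
  exact (Place.continuous_val ha).norm.continuousAt.eventually (lt_mem_nhds (by linarith))

/-- Up to a null set, the complement of a measurable set is a countable union of compact sets of finite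
measure. -/
theorem exists_compact_cover [Countable K] {S : Set (Place K)} (hS : MeasurableSet S) :
    ∃ C : ℕ → Set (Place K), (∀ j, IsCompact (C j)) ∧ (∀ j, G.measure (C j) ≠ ⊤) ∧
      (∀ j, C j ⊆ Sᶜ) ∧ ∀ᵐ p ∂G.measure, p ∉ S → p ∈ ⋃ j, C j := by
  have := G.sigmaFinite
  let B : ℕ → Set (Place K) := fun i => spanningSets G.measure i ∩ Sᶜ
  have hB : ∀ i, MeasurableSet (B i) := fun i => (measurableSet_spanningSets _ i).inter hS.compl
  have hBfin : ∀ i, G.measure (B i) ≠ ⊤ := fun i =>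
    ne_top_of_le_ne_top (measure_spanningSets_lt_top _ i).ne (measure_mono Set.inter_subset_left)
  -- Inner regularity on the Polish space of places approximates each finite-measure piece by
  -- compact sets.
  choose C hCB hC hlt using fun q : ℕ × ℕ => (hB q.1).exists_isCompact_sdiff_lt (hBfin q.1)
    (ε := ENNReal.ofReal (1 / ((q.2 : ℝ) + 1)))
    (by simpa using (Nat.one_div_pos_of_nat : 0 < 1 / ((q.2 : ℝ) + 1)))
  let e := Denumerable.eqv (ℕ × ℕ)
  refine ⟨fun j => C (e.symm j), fun j => hC _, fun j =>
    ne_top_of_le_ne_top (hBfin _) (measure_mono (hCB _)), fun j => (hCB _).trans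
    Set.inter_subset_right, ?_⟩
  have hnull : ∀ i, ∀ᵐ p ∂G.measure, p ∈ B i → p ∈ ⋃ j, C (e.symm j) := by
    intro i
    have h0 : G.measure (B i \ ⋃ j, C (e.symm j)) = 0 := by
      refine nonpos_iff_eq_zero.1 (ge_of_tendsto' (f := fun k : ℕ =>
        ENNReal.ofReal (1 / ((k : ℝ) + 1))) (x := atTop) ?_ fun k => ?_)
      · simpa using ENNReal.tendsto_ofReal tendsto_one_div_add_atTop_nhds_zero_nat
      · refine (measure_mono (Set.sdiff_subset_sdiff_right ?_)).trans (hlt (i, k)).le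
        refine Set.subset_iUnion_of_subset (e (i, k)) ?_
        rw [Equiv.symm_apply_apply]
    rw [ae_iff]
    refine measure_mono_null (fun p hp => ?_) h0
    have hp : ¬(p ∈ B i → p ∈ ⋃ j, C (e.symm j)) := hp
    push Not at hp
    exact hp
  filter_upwards [ae_all_iff.2 hnull] with p hp hpS
  obtain ⟨i, hi⟩ := Set.mem_iUnion.1 ((iUnion_spanningSets G.measure).symm ▸ Set.mem_univ p)
  exact hp i ⟨hi, hpS⟩

end GVF

/-! ### The points of an adelic set -/

section AdelicPoints

variable {K F : Type*} [Field K] [Field F] [Algebra K F] {n : ℕ} {G : GVF K}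
  {x : Fin (n + 1) → F} {S : Set (Place K)} {A : Set (Place (affRing K x))}

/-- The union of the fibres of an adelic set. -/
def adelicPoints (x : Fin (n + 1) → F) (S : Set (Place K)) (A : Set (Place (affRing K x))) :
    Set (Place (affRing K x)) :=
  {v | v ∈ adelicFibre x S A (v.res K)}

theorem mem_adelicPoints {v : Place (affRing K x)} : v ∈ adelicPoints x S A ↔
    (v.res K ∈ S → v ∈ A) ∧ (v.res K ∉ S → ∀ i, v (affCoord K x i) ≤ 1) := by
  change v ∈ adelicFibre x S A (v.res K) ↔ _
  unfold adelicFibre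
  split_ifs with h
  · simp [h]
  · simp [h]

theorem mem_adelicFibre {v : Place (affRing K x)} {p : Place K} :
    v ∈ adelicFibre x S A p ↔ v.res K = p ∧ v ∈ adelicPoints x S A := by
  have h : v ∈ adelicFibre x S A p → v.res K = p := by
    unfold adelicFibre
    split_ifs
    · exact fun h => h.2
    · exact fun h => h.1
  constructor
  · intro hv
    obtain rfl := h hv
    exact ⟨rfl, hv⟩
  · rintro ⟨rfl, hv⟩
    exact hv

theorem affRing_induction {P : affRing K x → Prop} (hx : ∀ i, P (affCoord K x i))
    (hK : ∀ a : K, P (algebraMap K _ a)) (hadd : ∀ f g, P f → P g → P (f + g))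
    (hmul : ∀ f g, P f → P g → P (f * g)) (f : affRing K x) : P f := by
  obtain ⟨f, hf⟩ := f
  induction hf using Algebra.adjoin_induction with
  | mem y hy =>
    obtain ⟨i, rfl⟩ := hy
    exact hx i
  | algebraMap r => exact hK r
  | add f g hf hg h h' => exact hadd _ _ h h'
  | mul f g hf hg h h' => exact hmul _ _ h h'

theorem Place.apply_two_eq_res {R : Type*} [CommRing R] [Algebra K R] (v : Place R) :
    v 2 = v.res K 2 := by
  change v 2 = v (algebraMap K R 2)
  rw [map_ofNat]

theorem exists_bound_of_isCompact {W : Set (Place (affRing K x))} {C : Set (Place K)}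
    (hC : IsCompact C) (hWC : ∀ v ∈ W, v.res K ∈ C)
    (hx : ∀ i, ∃ M : ℝ, ∀ v ∈ W, v (affCoord K x i) ≤ M) (f : affRing K x) :
    ∃ M : ℝ, ∀ v ∈ W, v f ≤ M := by
  have hK : ∀ a : K, ∃ M : ℝ, ∀ v ∈ W, v.res K a ≤ M := fun a => by
    obtain ⟨M, hM⟩ := hC.exists_bound_of_continuousOn (Place.continuous_apply a).continuousOn
    exact ⟨M, fun v hv => (le_abs_self _).trans (hM _ (hWC v hv))⟩
  induction f using affRing_induction with
  | hx i => exact hx i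
  | hK a => exact hK a
  | hadd f g hf hg =>
    obtain ⟨M, hM⟩ := hf
    obtain ⟨M', hM'⟩ := hg
    obtain ⟨N, hN⟩ := hK 2
    refine ⟨max 1 N * max M M', fun v hv => (v.add_le f g).trans ?_⟩
    refine mul_le_mul (max_le_max le_rfl ?_) (max_le_max (hM v hv) (hM' v hv))
      (le_max_of_le_left (v.nonneg f)) (le_max_of_le_left zero_le_one)
    rw [v.apply_two_eq_res (K := K)]
    exact hN v hv
  | hmul f g hf hg =>
    obtain ⟨M, hM⟩ := hf
    obtain ⟨M', hM'⟩ := hg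
    refine ⟨M * M', fun v hv => ?_⟩
    rw [v.mul]
    exact mul_le_mul (hM v hv) (hM' v hv) (v.nonneg g) ((v.nonneg f).trans (hM v hv))

theorem isCompact_adelicPoints_inter {C : Set (Place K)} (hC : IsCompact C) (hCS : C ⊆ Sᶜ) :
    IsCompact (adelicPoints x S A ∩ Place.res K ⁻¹' C) := by
  have heq : adelicPoints x S A ∩ Place.res K ⁻¹' C =
      {v | ∀ i, v (affCoord K x i) ≤ 1} ∩ Place.res K ⁻¹' C := by
    ext v
    refine and_congr_left fun h => ?_
    have : v.res K ∉ S := hCS h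
    rw [mem_adelicPoints]
    simp [this]
  rw [heq]
  refine Place.isCompact_of_isClosed (.inter ?_ (hC.isClosed.preimage Place.continuous_res))
    (exists_bound_of_isCompact hC (fun v hv => hv.2) fun i => ⟨1, fun v hv => hv.1 i⟩)
  rw [Set.ofPred_forall]
  exact isClosed_iInter fun i => isClosed_le (Place.continuous_apply _) continuous_const

namespace IsAdelicSet

theorem adelicPoints_eq (hA : IsAdelicSet G x S A) : adelicPoints x S A =
    A ∪ ({v | ∀ i, v (affCoord K x i) ≤ 1} ∩ Place.res K ⁻¹' Sᶜ) := by
  ext v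
  rw [mem_adelicPoints]
  by_cases h : v.res K ∈ S
  · simp [h]
  · have : v ∉ A := fun hv => h (hA.above v hv)
    simp [h, this]

theorem measurableSet_adelicPoints (hA : IsAdelicSet G x S A) :
    MeasurableSet (adelicPoints x S A) := by
  rw [hA.adelicPoints_eq]
  refine hA.isCompact.measurableSet.union (.inter ?_ (Place.measurable_res
    hA.isCompact_base.measurableSet.compl))
  rw [Set.ofPred_forall]
  exact .iInter fun i => measurableSet_le (Place.measurable_apply _) measurable_const

theorem inter_preimage_base (hA : IsAdelicSet G x S A) :
    adelicPoints x S A ∩ Place.res K ⁻¹' S = A := by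
  ext v
  rw [Set.mem_inter_iff, mem_adelicPoints]
  exact ⟨fun h => h.1.1 h.2, fun h => ⟨⟨fun _ => h, fun h' => (h' (hA.above v h)).elim⟩,
    hA.above v h⟩⟩

/-- The piece of index `0` is `S`, above which `Z` is `A`; the others lie off `S`, where integrality
of the coordinates gives compactness. -/
theorem exists_cover [Countable K] (hA : IsAdelicSet G x S A) :
    ∃ C : ℕ → Set (Place K), (∀ j, MeasurableSet (C j)) ∧ (∀ j, G.measure (C j) ≠ ⊤) ∧
      (∀ j, IsCompact (adelicPoints x S A ∩ Place.res K ⁻¹' C j)) ∧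
      ∀ᵐ p ∂G.measure, p ∈ ⋃ j, C j := by
  obtain ⟨C, hC, hfin, hsub, hcov⟩ := G.exists_compact_cover hA.isCompact_base.measurableSet
  refine ⟨fun j => Nat.casesOn j S C, ?_, ?_, ?_, ?_⟩
  · rintro (_ | j)
    · exact hA.isCompact_base.measurableSet
    · exact (hC j).measurableSet
  · rintro (_ | j)
    · exact (G.measure_lt_top_of_isCompact hA.isCompact_base hA.base_subset).ne
    · exact hfin j
  · rintro (_ | j)
    · change IsCompact (_ ∩ Place.res K ⁻¹' S)
      rw [hA.inter_preimage_base]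
      exact hA.isCompact
    · exact isCompact_adelicPoints_inter (hC j) (hsub j)
  · filter_upwards [hcov] with p hp
    by_cases h : p ∈ S
    · exact Set.mem_iUnion.2 ⟨0, h⟩
    · obtain ⟨j, hj⟩ := Set.mem_iUnion.1 (hp h)
      exact Set.mem_iUnion.2 ⟨j + 1, hj⟩

/-- Coordinates are bounded on the compact `A` and by `1` elsewhere, while scalars have integrable
logarithms. In sums, the factor `2` of the weak triangle inequality is treated as a scalar. -/
theorem exists_integrable_bound (hA : IsAdelicSet G x S A) (f : affRing K x) :
    ∃ H : Place K → ℝ, Integrable H G.measure ∧ (∀ p, 0 ≤ H p) ∧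
      ∀ v ∈ adelicPoints x S A, v f ≤ Real.exp (H (v.res K)) := by
  have hK : ∀ a : K, ∃ H : Place K → ℝ, Integrable H G.measure ∧ (∀ p, 0 ≤ H p) ∧
      ∀ p : Place K, max 1 (p a) ≤ Real.exp (H p) := by
    intro a
    rcases eq_or_ne a 0 with rfl | ha
    · exact ⟨0, integrable_zero _ _ _, fun _ => le_rfl, fun v => by simp [Place.zero]⟩
    refine ⟨fun p => |p.val a|, (G.integrable a ha).abs, fun _ => abs_nonneg _, fun v =>
      max_le (Real.one_le_exp_iff.2 (abs_nonneg _)) ?_⟩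
    rw [← Real.log_le_iff_le_exp (v.pos_of_ne_zero ha)]
    exact (le_abs_self _).trans_eq (abs_neg _).symm
  induction f using affRing_induction with
  | hx i =>
    obtain ⟨M, hM⟩ := hA.isCompact.exists_bound_of_continuousOn
      (Place.continuous_apply (affCoord K x i)).continuousOn
    refine ⟨S.indicator fun _ => Real.log (max 1 M),
      (integrable_indicator_iff hA.isCompact_base.measurableSet).2 (integrableOn_const
        (G.measure_lt_top_of_isCompact hA.isCompact_base hA.base_subset).ne),
      fun p => Set.indicator_nonneg (fun _ _ => Real.log_nonneg (le_max_left _ _)) _,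
      fun v hv => ?_⟩
    rw [mem_adelicPoints] at hv
    by_cases h : v.res K ∈ S
    · rw [Set.indicator_of_mem h, Real.exp_log (lt_max_of_lt_left one_pos)]
      exact ((le_abs_self _).trans (hM v (hv.1 h))).trans (le_max_right _ _)
    · rw [Set.indicator_of_notMem h, Real.exp_zero]
      exact hv.2 h i
  | hK a =>
    obtain ⟨H, hH, h0, h⟩ := hK a
    exact ⟨H, hH, h0, fun v _ => (le_max_right _ _).trans (h (v.res K))⟩
  | hadd f g hf hg =>
    obtain ⟨H, hH, h0, h⟩ := hf
    obtain ⟨H', hH', h0', h'⟩ := hg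
    obtain ⟨N, hN, hN0, hN'⟩ := hK 2
    refine ⟨fun p => N p + (H p + H' p), hN.add (hH.add hH'), fun p =>
      add_nonneg (hN0 p) (add_nonneg (h0 p) (h0' p)), fun v hv => (v.add_le f g).trans ?_⟩
    rw [Real.exp_add, v.apply_two_eq_res (K := K)]
    refine mul_le_mul (hN' _) (max_le ((h v hv).trans (Real.exp_le_exp.2 ?_))
      ((h' v hv).trans (Real.exp_le_exp.2 ?_))) (le_max_of_le_left (v.nonneg f)) (Real.exp_pos _).le
    · linarith [h0' (v.res K)]
    · linarith [h0 (v.res K)]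
  | hmul f g hf hg =>
    obtain ⟨H, hH, h0, h⟩ := hf
    obtain ⟨H', hH', h0', h'⟩ := hg
    refine ⟨fun p => H p + H' p, hH.add hH', fun p => add_nonneg (h0 p) (h0' p), fun v hv => ?_⟩
    rw [v.mul, Real.exp_add]
    exact mul_le_mul (h v hv) (h' v hv) (v.nonneg g) (Real.exp_pos _).le

end IsAdelicSet

end AdelicPoints

/-! ### Extended integrals -/

theorem le_eintegral {α : Type*} [MeasurableSpace α] {μ : Measure α} {g : α → EReal} {h : α → ℝ}
    (hh : Integrable h μ) (hle : ∀ a, (h a : EReal) ≤ g a) :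
    ((∫ a, h a ∂μ : ℝ) : EReal) ≤ eintegral μ g := by
  rw [integral_eq_lintegral_pos_part_sub_lintegral_neg_part hh, EReal.coe_sub]
  refine EReal.sub_le_sub ?_ ?_
  · rw [EReal.coe_ennreal_toReal hh.lintegral_lt_top.ne]
    refine EReal.coe_ennreal_le_coe_ennreal_iff.2 (lintegral_mono fun a => ?_)
    rw [← EReal.real_coe_toENNReal]
    exact EReal.toENNReal_le_toENNReal (hle a)
  · have hneg : ∫⁻ a, ENNReal.ofReal (-h a) ∂μ ≠ ⊤ := hh.neg.lintegral_lt_top.ne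
    rw [EReal.coe_ennreal_toReal hneg]
    refine EReal.coe_ennreal_le_coe_ennreal_iff.2 (lintegral_mono fun a => ?_)
    rw [← EReal.real_coe_toENNReal]
    exact EReal.toENNReal_le_toENNReal (by simpa using EReal.neg_le_neg_iff.2 (hle a))

theorem eintegral_map_le {α β : Type*} [MeasurableSpace α] [MeasurableSpace β] {μ : Measure α}
    {π : α → β} (hπ : Measurable π) {g : β → EReal} (hg : AEMeasurable g (μ.map π)) {k : α → ℝ}
    (hk : Integrable k μ) (hle : ∀ᵐ a ∂μ, g (π a) ≤ k a) :
    eintegral (μ.map π) g ≤ ((∫ a, k a ∂μ : ℝ) : EReal) := by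
  rw [integral_eq_lintegral_pos_part_sub_lintegral_neg_part hk, EReal.coe_sub]
  refine EReal.sub_le_sub ?_ ?_
  · rw [EReal.coe_ennreal_toReal hk.lintegral_lt_top.ne]
    refine EReal.coe_ennreal_le_coe_ennreal_iff.2 ?_
    rw [lintegral_map' hg.ereal_toENNReal hπ.aemeasurable]
    refine lintegral_mono_ae (hle.mono fun a ha => ?_)
    rw [← EReal.real_coe_toENNReal]
    exact EReal.toENNReal_le_toENNReal ha
  · have hneg : ∫⁻ a, ENNReal.ofReal (-k a) ∂μ ≠ ⊤ := hk.neg.lintegral_lt_top.ne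
    rw [EReal.coe_ennreal_toReal hneg]
    refine EReal.coe_ennreal_le_coe_ennreal_iff.2 ?_
    have hgn : AEMeasurable (fun b => (-g b).toENNReal) (μ.map π) :=
      (measurable_neg.comp_aemeasurable hg).ereal_toENNReal
    rw [lintegral_map' hgn hπ.aemeasurable]
    refine lintegral_mono_ae (hle.mono fun a ha => ?_)
    rw [← EReal.real_coe_toENNReal]
    exact EReal.toENNReal_le_toENNReal (by simpa using EReal.neg_le_neg_iff.2 ha)

namespace Place

variable {R : Type*} [CommRing R]

theorem coe_le_ord {v : Place R} {f : R} {h : ℝ} (hv : v f ≤ Real.exp (-h)) :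
    (h : EReal) ≤ v.ord f := by
  rw [ord, EReal.le_neg, ← EReal.coe_neg, ← Real.log_exp (-h),
    ← ENNReal.log_ofReal_of_pos (Real.exp_pos _)]
  exact ENNReal.log_le_log_iff.2 (ENNReal.ofReal_le_ofReal hv)

theorem ord_eq_val {F : Type*} [Field F] (v : Place F) {f : F} (hf : f ≠ 0) :
    v.ord f = (v.val f : EReal) := by
  rw [ord, ENNReal.log_ofReal_of_pos (v.pos_of_ne_zero hf), ← EReal.coe_neg]
  rfl

theorem continuous_ord (f : R) : Continuous fun v : Place R => v.ord f :=
  (ENNReal.continuous_log.comp (ENNReal.continuous_ofReal.comp (continuous_apply f))).neg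

end Place

/-! ### Global sections and the Chebyshev constant -/

section GlobalSections

variable {K F : Type*} [Field K] [Field F] [Algebra K F] {n : ℕ} {x : Fin (n + 1) → F}

theorem mul_mem_globalSections {f g : F} {m m' : ℕ} (hf : f ∈ globalSections K x m)
    (hg : g ∈ globalSections K x m') : f * g ∈ globalSections K x (m + m') := fun i hi => by
  rw [pow_add, mul_div_mul_comm]
  exact mul_mem (hf i hi) (hg i hi)

theorem one_mem_globalSections (hx : x 0 = 1) (m : ℕ) : (1 : F) ∈ globalSections K x m :=
  fun i _ => by
    rw [← one_div_pow]
    have h0 : 1 / x i ∈ Algebra.adjoin K (Set.range fun j => x j / x i) :=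
      Algebra.subset_adjoin ⟨0, by simp [hx]⟩
    exact pow_mem h0 m

theorem pow_mem_globalSections {f : F} {m : ℕ} (hf : f ∈ globalSections K x m) (k : ℕ) :
    f ^ k ∈ globalSections K x (k * m) := fun i hi => by
  rw [mul_comm, pow_mul, ← div_pow]
  exact pow_mem (hf i hi) k

theorem globalSections_mono (hx : x 0 = 1) {m m' : ℕ} (h : m ≤ m') :
    globalSections K x m ⊆ globalSections K x m' := fun f hf => by
  obtain ⟨k, rfl⟩ := Nat.exists_eq_add_of_le h
  simpa using mul_mem_globalSections hf (one_mem_globalSections (K := K) hx k)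

theorem exists_mem_globalSections (hx : x 0 = 1) (f : affRing K x) :
    ∃ m, 0 < m ∧ (f : F) ∈ globalSections K x m := by
  induction f using affRing_induction with
  | hx j =>
    refine ⟨1, one_pos, fun i _ => ?_⟩
    rw [pow_one]
    exact Algebra.subset_adjoin ⟨j, rfl⟩
  | hK a =>
    refine ⟨1, one_pos, fun i hi => ?_⟩
    have := one_mem_globalSections (K := K) hx 1 i hi
    rw [← mul_one_div]
    exact mul_mem (Subalgebra.algebraMap_mem _ a) this
  | hadd f g hf hg =>
    obtain ⟨m, hm, hf⟩ := hf
    obtain ⟨m', -, hg⟩ := hg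
    refine ⟨m + m', by omega, fun i hi => ?_⟩
    rw [Subalgebra.coe_add, add_div]
    exact add_mem (globalSections_mono hx (Nat.le_add_right m m') hf i hi)
      (globalSections_mono hx (Nat.le_add_left m' m) hg i hi)
  | hmul f g hf hg =>
    obtain ⟨m, hm, hf⟩ := hf
    obtain ⟨m', -, hg⟩ := hg
    exact ⟨m + m', by omega, mul_mem_globalSections hf hg⟩

variable {G : GVF K} {S : Set (Place K)} {A : Set (Place (affRing K x))}

theorem integral_le_infIntegral {f : affRing K x} {h : Place K → ℝ} (hh : Integrable h G.measure)
    (hle : ∀ v ∈ adelicPoints x S A, v f ≤ Real.exp (-h (v.res K))) :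
    ((∫ p, h p ∂G.measure : ℝ) : EReal) ≤ infIntegral G x S A f :=
  le_eintegral hh fun p => le_iInf₂ fun v hv => by
    obtain ⟨rfl, hv⟩ := mem_adelicFibre.1 hv
    exact Place.coe_le_ord (hle v hv)

/-- If `f` is in `L(mD)`, then `f ^ N` is in `L(NmD)` and multiplies the lower bound `h` by `N`.
Thus `∫ h / m` is at most the terms `a_{Nm} / (Nm)`, whose upper limit is at most `0`. -/
theorem integral_nonpos_of_one_le_chebyshev (hx : x 0 = 1) (hCh : 1 ≤ chebyshev G x S A)
    {f : affRing K x} (hf : f ≠ 0) {h : Place K → ℝ} (hh : Integrable h G.measure)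
    (hle : ∀ v ∈ adelicPoints x S A, v f ≤ Real.exp (-h (v.res K))) :
    ∫ p, h p ∂G.measure ≤ 0 := by
  rw [chebyshev, EReal.one_le_exp_iff, EReal.le_neg, neg_zero] at hCh
  by_contra! hpos
  obtain ⟨m, hm, hfm⟩ := exists_mem_globalSections hx f
  set I := ∫ p, h p ∂G.measure with hI
  have hfreq : ∃ᶠ N in atTop, ((I / m : ℝ) : EReal) ≤ chebyshevTerm G x S A N / (N : EReal) := by
    refine frequently_atTop.2 fun N => ⟨(N + 1) * m, by nlinarith, ?_⟩
    have h1 : (((N + 1 : ℕ) * I : ℝ) : EReal) ≤ chebyshevTerm G x S A ((N + 1) * m) := by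
      have h2 := integral_le_infIntegral (G := G) (S := S) (A := A) (f := f ^ (N + 1))
        (hh.const_mul ((N + 1 : ℕ) : ℝ)) fun v hv => by
          rw [Place.map_pow]
          refine (pow_le_pow_left₀ (v.nonneg f) (hle v hv) _).trans_eq ?_
          rw [← Real.exp_nat_mul]
          congr 1
          ring
      rw [integral_const_mul] at h2
      refine h2.trans (le_iSup_of_le (f ^ (N + 1)) (le_iSup₂_of_le ?_ (pow_ne_zero _ hf) le_rfl))
      rw [Subalgebra.coe_pow]
      exact pow_mem_globalSections hfm (N + 1)
    have hNm : (0 : ℝ) < ((N + 1) * m : ℕ) := by exact_mod_cast Nat.mul_pos N.succ_pos hm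
    have h3 : (((N + 1) * m : ℕ) : EReal) = ((((N + 1) * m : ℕ) : ℝ) : EReal) := rfl
    rw [h3]
    refine le_trans (le_of_eq ?_) (EReal.div_le_div_right_of_nonneg
      (EReal.coe_nonneg.2 hNm.le) h1)
    rw [← EReal.coe_div]
    congr 1
    have : (m : ℝ) ≠ 0 := by positivity
    have : ((N : ℝ) + 1) ≠ 0 := by positivity
    push_cast
    field_simp
  have := (le_limsup_of_frequently_le hfreq).trans hCh
  rw [← EReal.coe_zero, EReal.coe_le_coe_iff] at this
  have hIm : 0 < I / m := by positivity
  linarith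

theorem one_le_chebyshev_of_infIntegral_nonpos
    (h : ∀ f : affRing K x, f ≠ 0 → infIntegral G x S A f ≤ 0) : 1 ≤ chebyshev G x S A := by
  rw [chebyshev, EReal.one_le_exp_iff, EReal.le_neg, neg_zero]
  refine limsup_le_of_le (h := Eventually.of_forall fun m => ?_)
  exact EReal.div_nonpos_of_nonpos_of_nonneg
    (iSup_le fun f => iSup₂_le fun _ hf => h f hf) (by positivity)

/-- Above each piece `C j`, the set where the infimum is below `t` is a countable union, over
rationals `q < t`, of images of compact sets `{v(f) ≤ q}`. -/
theorem IsAdelicSet.aemeasurable_iInf_ord [Countable K] (hA : IsAdelicSet G x S A)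
    (f : affRing K x) :
    AEMeasurable (fun p => ⨅ v ∈ adelicFibre x S A p, v.ord f) G.measure := by
  obtain ⟨C, hCm, -, hCZ, hcov⟩ := hA.exists_cover
  rw [← Measure.restrict_eq_self_of_ae_mem hcov, aemeasurable_iUnion_iff]
  refine fun j => aemeasurable_restrict_of_measurable_subtype (hCm j) (measurable_of_Iio fun t => ?_)
  have key : (fun p : C j => ⨅ v ∈ adelicFibre x S A p, v.ord f) ⁻¹' Set.Iio t =
      Subtype.val ⁻¹' ⋃ q : {q : ℚ // ((q : ℝ) : EReal) < t},
        Place.res K '' (adelicPoints x S A ∩ Place.res K ⁻¹' C j ∩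
          {v | v.ord f ≤ ((q.1 : ℝ) : EReal)}) := by
    ext ⟨p, hp⟩
    simp only [Set.mem_preimage, Set.mem_Iio, iInf_lt_iff, Set.mem_iUnion, Set.mem_image,
      Set.mem_inter_iff, Set.mem_ofPred_eq, mem_adelicFibre]
    constructor
    · rintro ⟨v, ⟨rfl, hv⟩, hlt⟩
      obtain ⟨q, hq, hqt⟩ := EReal.lt_iff_exists_rat_btwn.1 hlt
      exact ⟨⟨q, hqt⟩, v, ⟨⟨hv, hp⟩, hq.le⟩, rfl⟩
    · rintro ⟨⟨q, hqt⟩, v, ⟨⟨hv, -⟩, hle⟩, rfl⟩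
      exact ⟨v, ⟨rfl, hv⟩, hle.trans_lt hqt⟩
  rw [key]
  refine measurable_subtype_coe (.iUnion fun q => IsCompact.measurableSet ?_)
  exact ((hCZ j).inter_right (isClosed_le (Place.continuous_ord f) continuous_const)).image
    Place.continuous_res

end GlobalSections

section Realization

variable {K F : Type*} [Field K] [Field F] [Algebra K F] {n : ℕ} {x : Fin (n + 1) → F}
  {G : GVF K} {S : Set (Place K)} {A : Set (Place (affRing K x))}

/-! ### Realized types have nonpositive integrals -/

theorem Place.measurableSet_res_isTrivial [Countable K] :
    MeasurableSet {v : Place F | (v.res K).IsTrivial} := by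
  have : {v : Place F | (v.res K).IsTrivial} =
      ⋂ a : {a : K // a ≠ 0}, {v | v (algebraMap K F a) = 1} := by
    ext v
    simp only [Set.mem_iInter, Subtype.forall]
    rfl
  rw [this]
  exact .iInter fun a => Place.measurable_apply _ (measurableSet_singleton 1)

theorem localHeight_nonneg (x : Fin (n + 1) → F) (v : Place F) : 0 ≤ localHeight x v :=
  Real.iSup_nonneg fun _ => Real.posLog_nonneg

theorem posLog_le_localHeight (x : Fin (n + 1) → F) (v : Place F) (i : Fin (n + 1)) :
    Real.posLog (v (x i)) ≤ localHeight x v :=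
  le_ciSup (f := fun i => Real.posLog (v (x i))) (Set.finite_range _).bddAbove i

theorem localHeight_eq_zero_iff {v : Place F} :
    localHeight x v = 0 ↔ ∀ i, v (x i) ≤ 1 := by
  constructor
  · intro h i
    have := (posLog_le_localHeight x v i).antisymm (h ▸ Real.posLog_nonneg)
    rw [h] at this
    simpa [abs_of_nonneg (v.nonneg _)] using Real.posLog_eq_zero_iff _ |>.1 this
  · intro h
    refine le_antisymm (ciSup_le fun i => ?_) (localHeight_nonneg x v)
    exact ((Real.posLog_eq_zero_iff _).2 (by simpa [abs_of_nonneg (v.nonneg _)] using h i)).le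

theorem measurable_localHeight (x : Fin (n + 1) → F) : Measurable (localHeight x) :=
  .iSup fun i => measurable_const.max (Real.measurable_log.comp (Place.measurable_apply (x i)))

theorem GVF.integrable_localHeight (G' : GVF F) (x : Fin (n + 1) → F) :
    Integrable (localHeight x) G'.measure := by
  have hint : ∀ i, Integrable (fun v : Place F => |v.val (x i)|) G'.measure := fun i => by
    rcases eq_or_ne (x i) 0 with h | h
    · simp [h, Place.val, Place.zero]
    · exact (G'.integrable _ h).abs
  refine (integrable_finsetSum Finset.univ fun i _ => hint i).mono'
    (measurable_localHeight x).aestronglyMeasurable (Eventually.of_forall fun v => ?_)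
  rw [Real.norm_of_nonneg (localHeight_nonneg x v)]
  refine ciSup_le fun i => le_trans ?_ (Finset.single_le_sum (f := fun i => |v.val (x i)|)
    (fun i _ => abs_nonneg _) (Finset.mem_univ i))
  rw [Real.posLog_def]
  exact max_le (abs_nonneg _) ((le_abs_self _).trans_eq (abs_neg _).symm)

/-- Triviality on `K` gives `|2| ≤ 1`, so the weak triangle inequality becomes ultrametric. -/
theorem Place.apply_le_one_of_res_isTrivial {v : Place F} (hv : (v.res K).IsTrivial)
    (hx : ∀ i, v (x i) ≤ 1) (f : affRing K x) : v (f : F) ≤ 1 := by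
  have hK : ∀ a : K, v.res K a ≤ 1 := fun a => by
    rcases eq_or_ne a 0 with rfl | ha
    · rw [Place.zero]
      exact zero_le_one
    · exact (hv a ha).le
  induction f using affRing_induction with
  | hx i => exact hx i
  | hK a => exact hK a
  | hadd f g hf hg =>
    refine (v.add_le (f : F) g).trans ?_
    rw [v.apply_two_eq_res (K := K), max_eq_left (hK 2), one_mul]
    exact max_le hf hg
  | hmul f g hf hg =>
    rw [Subalgebra.coe_mul, v.mul]
    exact mul_le_one₀ hf (v.nonneg _) hg

theorem infIntegral_nonpos_of_mem_adelicType [Countable K] (hA : IsAdelicSet G x S A) {G' : GVF F}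
    (hG' : G' ∈ adelicType G x S A) {f : affRing K x} (hf : f ≠ 0) :
    infIntegral G x S A f ≤ 0 := by
  obtain ⟨hext, hmem, hheight⟩ := hG'
  have hf0 : (f : F) ≠ 0 := fun h => hf (Subtype.ext h)
  have hSm : MeasurableSet {v : Place F | v.res K ∈ S} :=
    Place.measurable_res hA.isCompact_base.measurableSet
  have hx1 : ∀ᵐ v ∂G'.measure, v.res K ∉ S → ∀ i, v (x i) ≤ 1 := by
    have hi := G'.integrable_localHeight x
    have h0 : ∫ v in {v : Place F | v.res K ∈ S}ᶜ, localHeight x v ∂G'.measure = 0 := by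
      have := integral_add_compl hSm hi
      linarith
    rw [setIntegral_eq_zero_iff_of_nonneg_ae
      (Eventually.of_forall fun v => localHeight_nonneg x v) hi.integrableOn] at h0
    filter_upwards [(ae_restrict_iff' hSm.compl).1 h0] with v hv hvS
    exact localHeight_eq_zero_iff.1 (hv hvS)
  have hpts : ∀ᵐ v ∂G'.measure, v.comap (algebraMap (affRing K x) F) ∈ adelicPoints x S A := by
    filter_upwards [hmem, hx1] with v h1 h2
    exact mem_adelicPoints.2 ⟨h1, h2⟩
  let W : Set (Place F) := {v | ¬ (v.res K).IsTrivial}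
  have hW : MeasurableSet W := Place.measurableSet_res_isTrivial.compl
  have hval := G'.integrable (f : F) hf0
  have hle : ∀ᵐ v ∂G'.measure.restrict W,
      (⨅ w ∈ adelicFibre x S A (v.res K), w.ord f) ≤ (v.val (f : F) : EReal) := by
    filter_upwards [ae_restrict_of_ae hpts] with v hv
    rw [← v.ord_eq_val hf0]
    exact iInf₂_le (v.comap (algebraMap (affRing K x) F)) (mem_adelicFibre.2 ⟨rfl, hv⟩)
  have hmeas := hA.aemeasurable_iInf_ord f
  rw [infIntegral]
  rw [← show _ = G.measure from hext] at hmeas ⊢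
  refine (eintegral_map_le Place.measurable_res hmeas hval.integrableOn hle).trans ?_
  rw [← EReal.coe_zero, EReal.coe_le_coe_iff]
  have hsplit := integral_add_compl hW hval
  rw [G'.product_formula _ hf0] at hsplit
  -- A place trivial on `K` cannot lie above `S`, whose points are nontrivial; hence its coordinates
  -- are integral.
  have hnn : 0 ≤ ∫ v in Wᶜ, v.val (f : F) ∂G'.measure := by
    refine setIntegral_nonneg_of_ae_restrict ?_
    filter_upwards [ae_restrict_of_ae hx1, ae_restrict_mem hW.compl] with v hv hvW
    have htriv : (v.res K).IsTrivial := not_not.1 hvW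
    exact v.val_nonneg_iff.2 (Place.apply_le_one_of_res_isTrivial htriv
      (hv fun hS => G.nontrivial _ (hA.base_subset hS) htriv) f)
  linarith

/-! ### Extension of places to the fraction field -/

theorem Place.exists_comap_eq {R : Type*} [CommRing R] [IsDomain R] [Algebra R F]
    [IsFractionRing R F] (v : Place R) (hv : ∀ f, f ≠ 0 → v f ≠ 0) :
    ∃ w : Place F, w.comap (algebraMap R F) = v := by
  have hne : ∀ {b : R}, b ≠ 0 → algebraMap R F b ≠ 0 := fun hb h =>
    hb (IsFractionRing.injective R F (h.trans (map_zero _).symm))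
  have hfrac : ∀ z : F, ∃ a b : R, b ≠ 0 ∧ z = algebraMap R F a / algebraMap R F b := fun z => by
    obtain ⟨a, b, hb, h⟩ := IsFractionRing.div_surjective R z
    exact ⟨a, b, nonZeroDivisors.ne_zero hb, h.symm⟩
  choose num den hden hz using hfrac
  let t : F → ℝ := fun z => v (num z) / v (den z)
  have key : ∀ (a b : R), b ≠ 0 → t (algebraMap R F a / algebraMap R F b) = v a / v b := by
    intro a b hb
    have h := hz (algebraMap R F a / algebraMap R F b)
    rw [div_eq_div_iff (hne hb) (hne (hden _)), ← map_mul, ← map_mul] at h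
    have h' := congrArg v (IsFractionRing.injective R F h)
    rw [v.mul, v.mul] at h'
    rw [div_eq_div_iff (hv _ (hden _)) (hv _ hb)]
    exact h'.symm
  have key1 : ∀ a : R, t (algebraMap R F a) = v a := fun a => by
    simpa [v.one] using key a 1 one_ne_zero
  refine ⟨⟨t, fun z => div_nonneg (v.nonneg _) (v.nonneg _), ?_, ?_, fun y z => ?_, ?_⟩, ?_⟩
  · simpa [v.zero] using key1 0
  · simpa [v.one] using key1 1
  · have h : y * z = algebraMap R F (num y * num z) / algebraMap R F (den y * den z) := by
      conv_lhs => rw [hz y, hz z]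
      rw [map_mul, map_mul, div_mul_div_comm]
    rw [h, key _ _ (mul_ne_zero (hden y) (hden z)), v.mul, v.mul, mul_div_mul_comm]
  · rcases v.nonarch_or_arch with h | ⟨σ, c, hc, h⟩
    · refine Or.inl fun y z => ?_
      have hd := mul_ne_zero (hden y) (hden z)
      have hpos : 0 < v (den y * den z) := (v.nonneg _).lt_of_ne' (hv _ hd)
      have hy : y = algebraMap R F (num y * den z) / algebraMap R F (den y * den z) := by
        rw [map_mul, map_mul, mul_div_mul_right _ _ (hne (hden z))]
        exact hz y
      have hz' : z = algebraMap R F (den y * num z) / algebraMap R F (den y * den z) := by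
        rw [map_mul, map_mul, mul_div_mul_left _ _ (hne (hden y))]
        exact hz z
      have hs : y + z = algebraMap R F (num y * den z + den y * num z) /
          algebraMap R F (den y * den z) := by
        rw [map_add, add_div, ← hy, ← hz']
      have ey : t y = v (num y * den z) / v (den y * den z) := by
        conv_lhs => rw [hy]
        exact key _ _ hd
      have ez : t z = v (den y * num z) / v (den y * den z) := by
        conv_lhs => rw [hz']
        exact key _ _ hd
      rw [hs, key _ _ hd, ey, ez, max_div_div_right hpos.le]
      exact div_le_div_of_nonneg_right (h _ _) hpos.le
    · have hinj : Function.Injective σ := (injective_iff_map_eq_zero σ).2 fun a ha => by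
        by_contra h0
        refine hv a h0 ?_
        rw [h, ha, norm_zero, Real.zero_rpow hc.ne']
      refine Or.inr ⟨IsFractionRing.lift hinj, c, hc, fun z => ?_⟩
      conv_rhs => rw [hz z]
      rw [map_div₀, IsFractionRing.lift_algebraMap, IsFractionRing.lift_algebraMap, norm_div,
        Real.div_rpow (norm_nonneg _) (norm_nonneg _), ← h, ← h]
  · exact Place.toFun_injective (funext key1)

theorem Place.comap_injective {R : Type*} [CommRing R] [IsDomain R] [Algebra R F]
    [IsFractionRing R F] :
    Function.Injective (Place.comap (algebraMap R F)) := fun v w h => by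
  refine Place.toFun_injective (funext fun z => ?_)
  obtain ⟨a, b, -, rfl⟩ := IsFractionRing.div_surjective R z
  have hab : ∀ c : R, v (algebraMap R F c) = w (algebraMap R F c) := fun c =>
    congrFun (congrArg Place.toFun h) c
  rw [div_eq_mul_inv, v.mul, w.mul, v.apply_inv, w.apply_inv, hab, hab]

end Realization

/-! ### Completing the measure to a globally valued field structure. -/

section Realization

variable {K F : Type*} [Field K] [Field F] [Algebra K F]

/-- The atomic measure with the given weights at the given places. -/
noncomputable def weightedDirac {ι : Type*} (w : ι → Place F) (c : ι → ℝ) : Measure (Place F) :=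
  Measure.sum fun i => ENNReal.ofReal (c i) • Measure.dirac (w i)

theorem ae_weightedDirac {ι : Type*} {w : ι → Place F} {c : ι → ℝ} {P : Place F → Prop}
    (hP : MeasurableSet {v | P v}) (h : ∀ i, P (w i)) : ∀ᵐ v ∂weightedDirac w c, P v := by
  rw [ae_iff]
  have hm : MeasurableSet {v | ¬P v} := hP.compl
  rw [weightedDirac, Measure.sum_apply _ hm, ENNReal.tsum_eq_zero]
  intro i
  rw [Measure.smul_apply, Measure.dirac_apply' _ hm, Set.indicator_of_notMem, smul_zero]
  exact fun hi => hi (h i)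

theorem integrable_val_weightedDirac {ι : Type*} {w : ι → Place F} {c : ι → ℝ}
    (hc : ∀ i, 0 ≤ c i) {f : F} (hfin : {i | w i f ≠ 1}.Finite) :
    Integrable (fun v => v.val f) (weightedDirac w c) ∧
      ∫ v, v.val f ∂weightedDirac w c = ∑ᶠ i, c i * (w i).val f := by
  have hsupp : ∀ i, w i f = 1 → (w i).val f = 0 := fun i hi => by
    rw [Place.val, hi, Real.log_one, neg_zero]
  have hint : Integrable (fun v => v.val f) (weightedDirac w c) := by
    refine ⟨(Place.measurable_val f).aestronglyMeasurable, ?_⟩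
    rw [hasFiniteIntegral_iff_enorm, weightedDirac, lintegral_sum_measure,
      tsum_eq_sum (s := hfin.toFinset)]
    · refine ENNReal.sum_lt_top.2 fun i _ => ?_
      rw [lintegral_smul_measure, lintegral_dirac' _ (Place.measurable_val f).enorm]
      exact ENNReal.mul_lt_top ENNReal.ofReal_lt_top enorm_lt_top
    · intro i hi
      have : w i f = 1 := by simpa using hi
      rw [lintegral_smul_measure, lintegral_dirac' _ (Place.measurable_val f).enorm, hsupp i this]
      simp
  refine ⟨hint, ?_⟩
  rw [weightedDirac] at hint ⊢
  have hterm : ∀ i, ∫ v, v.val f ∂(ENNReal.ofReal (c i) • Measure.dirac (w i)) =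
      c i * (w i).val f := fun i => by
    rw [integral_smul_measure, integral_dirac' _ _ (Place.measurable_val f).stronglyMeasurable,
      ENNReal.toReal_ofReal (hc i), smul_eq_mul]
  rw [integral_sum_measure hint]
  simp_rw [hterm]
  refine tsum_eq_finsum (hfin.subset fun i hi => ?_)
  exact fun h1 => hi (by simp [hsupp i h1])

theorem countable_of_finite_support [Countable F] {ι : Type*} {w : ι → Place F}
    (hw : ∀ i, ¬(w i).IsTrivial) (hfin : ∀ f ≠ 0, {i | w i f ≠ 1}.Finite) : Countable ι := by
  rw [← Set.countable_univ_iff]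
  have : (Set.univ : Set ι) = ⋃ f : {f : F // f ≠ 0}, {i | w i f.1 ≠ 1} := by
    refine (Set.eq_univ_of_forall fun i => ?_).symm
    have := hw i
    rw [Place.IsTrivial] at this
    push Not at this
    obtain ⟨f, hf, h⟩ := this
    exact Set.mem_iUnion.2 ⟨⟨f, hf⟩, h⟩
  rw [this]
  exact Set.countable_iUnion fun f => (hfin f.1 f.2).countable

/-- Equivalent places above `G.reps` have the same restriction to `K`, and a nontrivial value there
forces the exponent to be `1`. A place above `G.reps` is never equivalent to one trivial on `K`. -/
theorem GVF.eq_of_equivalent_of_mem_union (G : GVF K) {ι : Type*} {w : ι → Place F}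
    (hwK : ∀ i, ((w i).res K).IsTrivial)
    (hwinj : ∀ i j, (w i).Equivalent (w j) → w i = w j) :
    ∀ v ∈ {v : Place F | v.res K ∈ G.reps} ∪ Set.range w,
      ∀ u ∈ {v : Place F | v.res K ∈ G.reps} ∪ Set.range w, v.Equivalent u → v = u := by
  rintro v (hv | ⟨i, rfl⟩) u (hu | ⟨j, rfl⟩) h
  · obtain ⟨s, hs, h⟩ := h
    have heq : v.res K = u.res K :=
      G.inequivalent _ hv _ hu ⟨s, hs, fun a => h (algebraMap K F a)⟩
    obtain ⟨a, ha, hne⟩ := Place.exists_val_ne_zero (G.nontrivial _ hv)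
    have hs1 : s = 1 := by
      have h1 : u (algebraMap K F a) = v (algebraMap K F a) :=
        (congrFun (congrArg Place.toFun heq) a).symm
      have h2 := h (algebraMap K F a)
      have hpos := v.pos_of_ne_zero ((map_ne_zero (algebraMap K F)).2 ha)
      rw [h1] at h2
      have h3 := congrArg Real.log h2
      rw [Real.log_rpow hpos] at h3
      have h4 : Real.log (v (algebraMap K F a)) ≠ 0 := fun h0 => hne (by
        change -Real.log (v (algebraMap K F a)) = 0
        rw [h0, neg_zero])
      exact (mul_right_cancel₀ h4 ((one_mul _).trans h3)).symm
    exact Place.toFun_injective (funext fun z => by rw [h z, hs1, Real.rpow_one])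
  · refine (G.nontrivial _ hv fun a ha => ?_).elim
    obtain ⟨s, hs, h⟩ := h
    have h1 := (h (algebraMap K F a)).symm.trans (hwK j a ha)
    have h2 := v.nonneg (algebraMap K F a)
    exact (Real.rpow_left_inj h2 zero_le_one hs.ne').1 (h1.trans (Real.one_rpow s).symm)
  · refine (G.nontrivial _ hu fun a ha => ?_).elim
    obtain ⟨s, hs, h⟩ := h
    exact (h (algebraMap K F a)).trans (by
      rw [show w i (algebraMap K F a) = 1 from hwK i a ha, Real.one_rpow])
  · exact hwinj i j h

theorem GVF.measure_compl_union_eq_zero (G : GVF K) {ν : Measure (Place F)}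
    (hν : ν.map (Place.res K) = G.measure) {ι : Type*} [Countable ι] (w : ι → Place F)
    (c : ι → ℝ) :
    (ν + weightedDirac w c) ({v : Place F | v.res K ∈ G.reps} ∪ Set.range w)ᶜ = 0 := by
  have hm : MeasurableSet {v : Place F | v.res K ∈ G.reps} :=
    Place.measurable_res G.measurableSet_reps
  have h1 : ∀ᵐ v ∂ν, v.res K ∈ G.reps := by
    have := G.ae_mem_reps
    rw [← hν] at this
    exact ae_of_ae_map Place.measurable_res.aemeasurable this
  have h2 : ∀ᵐ v ∂weightedDirac w c, v ∈ Set.range w :=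
    ae_weightedDirac (Set.countable_range w).measurableSet fun i => Set.mem_range_self i
  rw [← mem_ae_iff]
  change ∀ᵐ v ∂(ν + weightedDirac w c), v ∈ {v : Place F | v.res K ∈ G.reps} ∪ Set.range w
  rw [ae_add_measure_iff]
  exact ⟨h1.mono fun v hv => Or.inl hv, h2.mono fun v hv => Or.inr hv⟩

/-- A measure of places above `G`, and an atomic measure of places trivial on `K`, which together satisfy
the product formula, are a globally valued field structure. -/
noncomputable def GVF.ofMeasures [Countable K] [Countable F] (G : GVF K) (ν : Measure (Place F))
    (hν : ν.map (Place.res K) = G.measure) {ι : Type*} (w : ι → Place F) (c : ι → ℝ)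
    (hc : ∀ i, 0 ≤ c i) (hwK : ∀ i, ((w i).res K).IsTrivial) (hw : ∀ i, ¬(w i).IsTrivial)
    (hwinj : ∀ i j, (w i).Equivalent (w j) → w i = w j)
    (hfin : ∀ f ≠ 0, {i | w i f ≠ 1}.Finite)
    (hint : ∀ f : F, f ≠ 0 → Integrable (fun v => v.val f) ν)
    (hprod : ∀ f : F, f ≠ 0 → -∫ v, v.val f ∂ν = ∑ᶠ i, c i * (w i).val f) : GVF F where
  reps := {v | v.res K ∈ G.reps} ∪ Set.range w
  measurableSet_reps := by
    have := countable_of_finite_support hw hfin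
    exact (Place.measurable_res G.measurableSet_reps).union (Set.countable_range w).measurableSet
  nontrivial := by
    rintro v (hv | ⟨i, rfl⟩)
    · exact fun h => G.nontrivial _ hv fun a ha => h _ ((map_ne_zero _).2 ha)
    · exact hw i
  inequivalent := G.eq_of_equivalent_of_mem_union hwK hwinj
  measure := ν + weightedDirac w c
  concentrated := by
    have := countable_of_finite_support hw hfin
    exact G.measure_compl_union_eq_zero hν w c
  integrable f hf := (hint f hf).add_measure (integrable_val_weightedDirac hc (hfin f hf)).1
  product_formula f hf := by
    obtain ⟨h1, h2⟩ := integrable_val_weightedDirac hc (hfin f hf)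
    rw [integral_add_measure (hint f hf) h1, h2, ← hprod f hf]
    ring

variable {n : ℕ} {x : Fin (n + 1) → F} {G : GVF K} {S : Set (Place K)}
  {A : Set (Place (affRing K x))}

theorem adelicType_nonempty_of_one_le_chebyshev [Countable K] [IsFractionRing (affRing K x) F]
    (hx : x 0 = 1) (hA : IsAdelicSet G x S A) (hCh : 1 ≤ chebyshev G x S A) :
    (adelicType G x S A).Nonempty := by
  have hft : Algebra.FiniteType K (affRing K x) := .adjoin_of_finite (Set.finite_range x)
  have : Countable (affRing K x) := by
    obtain ⟨m, θ, hθ⟩ := Algebra.FiniteType.iff_quotient_mvPolynomial''.1 hft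
    have : Countable (MvPolynomial (Fin m) K) := by
      rw [← Cardinal.mk_le_aleph0_iff]
      refine MvPolynomial.cardinalMk_le_max_lift.trans (max_le (max_le ?_ ?_) le_rfl)
      · exact Cardinal.lift_le_aleph0.2 Cardinal.mk_le_aleph0
      · exact Cardinal.lift_le_aleph0.2 Cardinal.mk_le_aleph0
    exact hθ.countable
  have : Countable F := by
    refine Function.Surjective.countable (f := fun q : affRing K x × affRing K x =>
      (q.1 : F) / q.2) fun z => ?_
    obtain ⟨a, b, -, h⟩ := IsFractionRing.div_surjective (affRing K x) z
    exact ⟨(a, b), h⟩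
  obtain ⟨C, hCm, hCμ, hCZ, hcov⟩ := hA.exists_cover
  obtain ⟨ν, hνmap, hνZ, hν⟩ := exists_measure_of_product_inequality
    hA.measurableSet_adelicPoints hA.exists_integrable_bound C hCm hCμ hCZ hcov
    fun f hf h hh hle => integral_nonpos_of_one_le_chebyshev hx hCh hf hh hle
  let j : Place F → Place (affRing K x) := Place.comap (algebraMap (affRing K x) F)
  -- By the Lusin-Souslin theorem, as `F` is countable and its space of places is Polish.
  have hj : MeasurableEmbedding j :=
    (Place.continuous_comap _).measurableEmbedding Place.comap_injective
  let νF := ν.comap j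
  have hνF : νF.map j = ν := by
    rw [hj.map_comap]
    -- Almost every semivaluation vanishes at no nonzero `f`, by countability of `K[x]`, and so
    -- extends to the fraction field.
    refine Measure.restrict_eq_self_of_ae_mem ?_
    have : ∀ᵐ v ∂ν, ∀ f : {f : affRing K x // f ≠ 0}, v f.1 ≠ 0 :=
      ae_all_iff.2 fun f => (hν f.1 f.2).1
    filter_upwards [this] with v hv
    exact v.exists_comap_eq fun f hf => hv ⟨f, hf⟩
  have hνFmap : νF.map (Place.res K) = G.measure := by
    rw [← hνmap, ← hνF, Measure.map_map Place.measurable_res hj.measurable]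
    rfl
  have hνFZ : ∀ᵐ v ∂νF, j v ∈ adelicPoints x S A := by
    rw [← hνF] at hνZ
    exact ae_of_ae_map hj.measurable.aemeasurable hνZ
  have hR : ∀ f : affRing K x, f ≠ 0 → Integrable (fun v : Place F => v.val (f : F)) νF ∧
      0 ≤ -∫ v, v.val (f : F) ∂νF := by
    intro f hf
    obtain ⟨-, h1, h2⟩ := hν f hf
    rw [← hνF, hj.integrable_map_iff] at h1
    rw [← hνF, hj.integral_map] at h2
    refine ⟨h1.neg, ?_⟩
    change 0 ≤ -∫ v, -Real.log (v (f : F)) ∂νF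
    rw [integral_neg, neg_neg]
    exact h2
  have hint : ∀ f : F, f ≠ 0 → Integrable (fun v => v.val f) νF := by
    intro f hf
    obtain ⟨a, b, hb, rfl⟩ := IsFractionRing.div_surjective (affRing K x) f
    have ha0 : algebraMap (affRing K x) F a ≠ 0 := fun h => hf (by rw [h, zero_div])
    have hb0 : algebraMap (affRing K x) F b ≠ 0 := fun h => hf (by rw [h, div_zero])
    have ha : a ≠ 0 := fun h => ha0 (by rw [h, map_zero])
    refine ((hR a ha).1.sub (hR b (nonZeroDivisors.ne_zero hb)).1).congr
      (Eventually.of_forall fun v => ?_)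
    change v.val (a : F) - v.val (b : F) = v.val ((a : F) / b)
    have h := v.val_mul ha0 (inv_ne_zero hb0)
    rw [v.val_inv] at h
    rw [div_eq_mul_inv, sub_eq_add_neg]
    exact h.symm
  obtain ⟨ι, w, c, hc, hw1, hw, hwinj, hfin, hφ⟩ := exists_divisorial_representation
    (K := K) (R := affRing K x) (F := F) (fun f => -∫ v, v.val f ∂νF)
    (fun f g hf hg => by
      simp_rw [fun v : Place F => v.val_mul hf hg]
      rw [integral_add (hint f hf) (hint g hg)]
      ring)
    (fun f hf => (hR f hf).2)
  -- Both `a` and `a⁻¹` belong to `K[x]`, on which `w i` is at most `1`.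
  have hwK : ∀ i, ((w i).res K).IsTrivial := fun i a ha => by
    refine Place.eq_one_of_le_one _ ha (hw1 i (algebraMap K (affRing K x) a)) ?_
    exact hw1 i (algebraMap K (affRing K x) a⁻¹)
  have hwS : ∀ i, (w i).res K ∉ S := fun i hi => G.nontrivial _ (hA.base_subset hi) (hwK i)
  have hSm : MeasurableSet {v : Place F | v.res K ∈ S} :=
    Place.measurable_res hA.isCompact_base.measurableSet
  have htm : MeasurableSet {v : Place F | (v.res K).IsTrivial} := Place.measurableSet_res_isTrivial
  refine ⟨G.ofMeasures νF hνFmap w c hc hwK hw hwinj hfin hint hφ, ?_, ?_, ?_⟩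
  · change ((νF + weightedDirac w c).restrict {v | ¬(v.res K).IsTrivial}).map (Place.res K) = _
    have h1 : νF.restrict {v | ¬(v.res K).IsTrivial} = νF := by
      refine Measure.restrict_eq_self_of_ae_mem ?_
      have h := G.ae_mem_reps
      rw [← hνFmap] at h
      filter_upwards [ae_of_ae_map Place.measurable_res.aemeasurable h] with v hv
      exact G.nontrivial _ hv
    have h2 : (weightedDirac w c).restrict {v | ¬(v.res K).IsTrivial} = 0 := by
      rw [Measure.restrict_eq_zero]
      exact ae_weightedDirac htm hwK
    rw [Measure.restrict_add, h1, h2, add_zero, hνFmap]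
  · change ∀ᵐ v ∂(νF + weightedDirac w c), _
    rw [ae_add_measure_iff]
    constructor
    · filter_upwards [hνFZ] with v hv
      exact (mem_adelicPoints.1 hv).1
    · filter_upwards [ae_weightedDirac (P := fun v => v.res K ∉ S) hSm.compl hwS] with v hv hv'
      exact (hv hv').elim
  · change ∫ v, localHeight x v ∂(νF + weightedDirac w c) =
      ∫ v in _, localHeight x v ∂(νF + weightedDirac w c)
    refine (setIntegral_eq_integral_of_ae_compl_eq_zero ?_).symm
    have hle : ∀ᵐ v ∂(νF + weightedDirac w c), v.res K ∉ S → ∀ i, v (x i) ≤ 1 := by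
      rw [ae_add_measure_iff]
      constructor
      · filter_upwards [hνFZ] with v hv
        exact (mem_adelicPoints.1 hv).2
      · have hm : MeasurableSet {v : Place F | ∀ i, v (x i) ≤ 1} := by
          rw [Set.ofPred_forall]
          exact .iInter fun i => measurableSet_le (Place.measurable_apply _) measurable_const
        filter_upwards [ae_weightedDirac (c := c) hm fun i k => hw1 i (affCoord K x k)]
          with v hv _ using hv
    filter_upwards [hle] with v hv hvS
    exact localHeight_eq_zero_iff.2 (hv hvS)

end Realization

/-! ### The function field as the fraction field of the affine coordinate ring. -/

namespace ProjVariety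

variable {K : Type*} [Field K] {n : ℕ} (X : ProjVariety K n)

theorem coord_zero : X.coord 0 = 1 := by
  refine Subtype.ext ?_
  change X.ratio 0 = 1
  refine div_self fun h => X.X_zero_notMem ?_
  rw [← Ideal.Quotient.eq_zero_iff_mem]
  exact IsFractionRing.injective X.HomCoordRing _ (h.trans (map_zero _).symm)

theorem isFractionRing_affRing : IsFractionRing (affRing K X.coord) X.functionField := by
  have hmem : ∀ y ∈ Algebra.adjoin K (Set.range X.ratio), ∃ a : affRing K X.coord,
      ((a : X.functionField) : FractionRing X.HomCoordRing) = y := by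
    intro y hy
    induction hy using Algebra.adjoin_induction with
    | mem y hy =>
      obtain ⟨i, rfl⟩ := hy
      exact ⟨affCoord K X.coord i, rfl⟩
    | algebraMap r => exact ⟨algebraMap K _ r, rfl⟩
    | add y z _ _ hy hz =>
      obtain ⟨a, rfl⟩ := hy
      obtain ⟨b, rfl⟩ := hz
      exact ⟨a + b, rfl⟩
    | mul y z _ _ hy hz =>
      obtain ⟨a, rfl⟩ := hy
      obtain ⟨b, rfl⟩ := hz
      exact ⟨a * b, rfl⟩
  refine IsFractionRing.of_field _ _ fun z => ?_
  obtain ⟨y, hy, y', hy', h⟩ := IntermediateField.mem_adjoin_iff_div.1 z.2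
  obtain ⟨a, ha⟩ := hmem y hy
  obtain ⟨b, hb⟩ := hmem y' hy'
  refine ⟨a, b, Subtype.ext ?_⟩
  rw [h, ← ha, ← hb]
  rfl

end ProjVariety

theorem mainTheorem8 {K : Type*} [Field K] [Countable K] (G : GVF K) {n : ℕ}
    (X : ProjVariety K n) (S : Set (Place K)) (A : Set (Place (affRing K X.coord)))
    (hA : IsAdelicSet G X.coord S A) :
    (adelicType G X.coord S A).Nonempty ↔ 1 ≤ chebyshev G X.coord S A := by
  have := X.isFractionRing_affRing
  refine ⟨fun ⟨G', hG'⟩ => one_le_chebyshev_of_infIntegral_nonpos fun f hf =>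
    infIntegral_nonpos_of_mem_adelicType hA hG' hf, fun h =>
    adelicType_nonempty_of_one_le_chebyshev X.coord_zero hA h⟩
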